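/- All graphs are finite and simple. An \emph{interval graph} is a graph that is the intersection graph of a finite family of closed intervals of the real line. An \emph{interval-completion} of a graph $F$ is an interval graph $H$ with $V(H)=V(F)$ and $E(H)\supseteq E(F)$; it is \emph{inclusion-wise minimal} if no interval-completion of $F$ has an edge set properly contained in $E(H)$. The \emph{line graph} $L(G)$ of $G=(V,E)$ has vertex set $E$, two distinct edges of $G$ being adjacent in it if they share an endpoint, and $\overline{F}$ denotes the complement of $F$. \textbf{Lemma.} Let $G=(V,E)$ be a graph on $n\ge 1$ vertices. Then $\overline{L(G)}$ has at most $n^5$ inclusion-wise minimal interval-completions. Moreover, they can be listed in $\mathcal{O}(n^7)$ time: there is an algorithm that, given $n\ge 1$ and the adjacency matrix of a graph $G$ with vertex set $\{0,\dots,n-1\}$, outputs all inclusion-wise minimal interval-completions $H$ of $\overline{L(G)}$, each exactly once and nothing else, where $H$ is output as the list of the edges of its complement $\overline{H}$ (a subgraph of $L(G)$), each edge exactly once; its running time, including the output, is $\mathcal{O}(n^7)$ on a unit-cost random access machine with words of $\mathcal{O}(\log n)$ bits. -/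

import Mathlib

/-- A graph is an interval graph if it is the intersection graph of a family of (nonempty)
closed intervals `[l v, r v]` of the real line, indexed by its vertices. -/
def IsIntervalGraph {W : Type*} (H : SimpleGraph W) : Prop :=
  ∃ l r : W → ℝ, (∀ v, l v ≤ r v) ∧
    ∀ u v, H.Adj u v ↔ u ≠ v ∧ (Set.Icc (l u) (r u) ∩ Set.Icc (l v) (r v)).Nonempty

/-- `H` is an interval-completion of `G`: an interval graph that contains `G` as a subgraph
(on the same vertex set, i.e. obtained from `G` by adding edges). -/
def IsIntervalCompletion {W : Type*} (G H : SimpleGraph W) : Prop :=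
  G ≤ H ∧ IsIntervalGraph H

/-- `H` is an inclusion-wise minimal interval-completion of `G`. -/
def IsMinimalIntervalCompletion {W : Type*} (G H : SimpleGraph W) : Prop :=
  Minimal (IsIntervalCompletion G) H

namespace RAM

/-! ### A random access machine with unit costs

Programs are structured programs over finitely many registers, a random access memory and a
write-only output stream, all of them consisting of words (natural numbers below a bound). -/

/-- A configuration: register contents, memory contents, and the words written so far. -/
structure State where
  reg : ℕ → ℕ
  mem : ℕ → ℕ
  out : List ℕ

/-- The elementary operations that compute one word; the arguments `a`, `b` name registers. -/
inductive Operation where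
  | const (c : ℕ)
  | add (a b : ℕ)
  | sub (a b : ℕ)
  | mul (a b : ℕ)
  | lt (a b : ℕ)
  | load (a : ℕ)

/-- The value of an operation: subtraction is truncated at `0`, a comparison gives `1` or `0`,
and `load a` reads the memory cell whose address is in register `a`. -/
def Operation.eval (s : State) : Operation → ℕ
  | .const c => c
  | .add a b => s.reg a + s.reg b
  | .sub a b => s.reg a - s.reg b
  | .mul a b => s.reg a * s.reg b
  | .lt a b => if s.reg a < s.reg b then 1 else 0
  | .load a => s.mem (s.reg a)

/-- Programs. `set r e` assigns the value of `e` to register `r`; `store a r` copies register `r`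
to the memory cell whose address is in register `a`; `write r` appends register `r` to the output;
`ite r p q` runs `p` if register `r` is nonzero and `q` otherwise; `loop r p` repeats `p` as long as
register `r` is nonzero. -/
inductive Program where
  | skip
  | set (r : ℕ) (e : Operation)
  | store (a r : ℕ)
  | write (r : ℕ)
  | seq (p q : Program)
  | ite (r : ℕ) (p q : Program)
  | loop (r : ℕ) (p : Program)

/-- `Exec B p s t s'`: started in `s`, the program `p` halts in `s'` after exactly `t` steps, and
every word that it computes is below `B` (a program that computes a larger one is stuck).
Every elementary operation, memory access, output of a word and test of a register
takes one step. -/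
inductive Exec (B : ℕ) : Program → State → ℕ → State → Prop where
  | skip (s : State) : Exec B .skip s 1 s
  | set (r : ℕ) (e : Operation) (s : State) (h : e.eval s < B) :
      Exec B (.set r e) s 1 { s with reg := Function.update s.reg r (e.eval s) }
  | store (a r : ℕ) (s : State) :
      Exec B (.store a r) s 1 { s with mem := Function.update s.mem (s.reg a) (s.reg r) }
  | write (r : ℕ) (s : State) :
      Exec B (.write r) s 1 { s with out := s.out ++ [s.reg r] }
  | seq {p q : Program} {s s₁ s₂ : State} {t₁ t₂ : ℕ}
      (hp : Exec B p s t₁ s₁) (hq : Exec B q s₁ t₂ s₂) : Exec B (.seq p q) s (t₁ + t₂) s₂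
  | ite_true {r : ℕ} {p q : Program} {s s' : State} {t : ℕ}
      (hr : s.reg r ≠ 0) (hp : Exec B p s t s') : Exec B (.ite r p q) s (t + 1) s'
  | ite_false {r : ℕ} {p q : Program} {s s' : State} {t : ℕ}
      (hr : s.reg r = 0) (hq : Exec B q s t s') : Exec B (.ite r p q) s (t + 1) s'
  | loop_done {r : ℕ} {p : Program} {s : State} (hr : s.reg r = 0) :
      Exec B (.loop r p) s 1 s
  | loop_step {r : ℕ} {p : Program} {s s₁ s₂ : State} {t₁ t₂ : ℕ}
      (hr : s.reg r ≠ 0) (hp : Exec B p s t₁ s₁) (hl : Exec B (.loop r p) s₁ t₂ s₂) :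
      Exec B (.loop r p) s (t₁ + t₂ + 1) s₂

open Classical in
/-- The initial configuration for an input graph on `{0, …, n-1}`: register `0` holds `n`, memory
cell `i * n + j` holds the entry `(i, j)` of the adjacency matrix, and everything else is `0`. -/
noncomputable def input {n : ℕ} (G : SimpleGraph (Fin n)) : State where
  reg := fun r => if r = 0 then n else 0
  mem := fun a => if ∃ i j : Fin n, a = (i : ℕ) * n + (j : ℕ) ∧ G.Adj i j then 1 else 0
  out := []

end RAM

/-- A pair of edges `{u, v}`, `{x, y}` of a graph on `{0, …, n-1}`, written as `((u, v), (x, y))`. -/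
abbrev EdgePair (n : ℕ) : Type := (Fin n × Fin n) × (Fin n × Fin n)

/-- The unordered pair `{{u, v}, {x, y}}`. -/
def EdgePair.toSym2 {n : ℕ} (q : EdgePair n) : Sym2 (Sym2 (Fin n)) :=
  s(s(q.1.1, q.1.2), s(q.2.1, q.2.2))

/-- The list `L` contains every edge of `F` exactly once, and nothing else, where `F` is a graph
whose vertices are the edges of `G`. -/
def ListsEdges {n : ℕ} {G : SimpleGraph (Fin n)} (L : List (EdgePair n))
    (F : SimpleGraph G.edgeSet) : Prop :=
  (L.map EdgePair.toSym2).Nodup ∧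
    ∀ z, z ∈ L.map EdgePair.toSym2 ↔ z ∈ Sym2.map Subtype.val '' F.edgeSet

/-- The words by which a list of pairs of edges is written: four words `u, v, x, y` for each pair,
and `n` as the end marker. -/
def wordsOf {n : ℕ} (L : List (EdgePair n)) : List ℕ :=
  L.flatMap (fun q => [(q.1.1 : ℕ), (q.1.2 : ℕ), (q.2.1 : ℕ), (q.2.2 : ℕ)]) ++ [n]

/-- The word sequence `out` lists all inclusion-wise minimal interval-completions of the complement
of the line graph of `G`, each of them exactly once and nothing else, where a completion `H` is
written as the list of the edges of its complement `Hᶜ` (a subgraph of the line graph). -/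
def ListsMinimalCompletions {n : ℕ} (G : SimpleGraph (Fin n)) (out : List ℕ) : Prop :=
  ∃ A : List (SimpleGraph G.edgeSet × List (EdgePair n)),
    (A.map Prod.fst).Nodup ∧
    (∀ H, H ∈ A.map Prod.fst ↔ IsMinimalIntervalCompletion G.lineGraphᶜ H) ∧
    (∀ x ∈ A, ListsEdges x.2 x.1ᶜ) ∧
    out = A.flatMap (fun x => wordsOf x.2)

/-!
Let `G` be a graph and `H` an interval-completion of the complement of its line graph. The
complement of `H` is a set of *cherries* of `G`, that is, of pairs of edges `{c, a}`, `{c, b}` with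
a common end `c`, the center; and `H` is an interval graph if and only if these pairs are the
comparable pairs of an interval order of the edges. So the minimal completions correspond to the
inclusion-wise maximal sets of cherries that come from interval orders in which comparable edges
have a common end.

Such an order is very restricted. The edge whose interval has the leftmost right end is comparable
to every edge that lies to the right of some edge, and the edge with the rightmost left end to every
edge that lies to the left of some edge. These two are themselves comparable, say `{u, v}` and `{u,
z}`, so every comparable pair consists of edges that meet them. Applying the same argument to the
runners-up leaves a star around `u` with two additional cherries, or one of three shapes with four
parameters (`IsEdgeOrder.exists_covers`). Conversely, each of these shapes is itself an interval
order (`isIntervalOrderSet_starShape` and the theorems that follow it). A shape with up to five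
parameters can be chosen such that every parameter is the center of a cherry
(`Shape.exists_isCandidate`); parameters that are not needed are dropped, which gives ten kinds of
nonempty shapes with one to five distinct parameters each. A shape on `j` distinct vertices is
encoded by a 5-tuple whose coincidences form a partition of the positions into `j` parts that tells
the kind of the shape. There are enough partitions for all kinds, so there are at most `n ^ 5`
minimal completions (`Shape.encard_isMinimalIntervalCompletion_le`).

For the algorithm, it remains to recognize which candidates `(t, s)` are maximal, and to choose one
of them for every maximal set of cherries (`Shape.IsSelected`). If the cherries of a candidate
belong to another shape, then its `j` parameters are centers there, and hence they are among the
parameters of that shape. Therefore the `5 - j` further vertices are enough to describe all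
competitors (`Shape.isSelected_iff`), and an inclusion is tested by running through the centers and
all pairs of ends in `O(n ^ 2)` steps. In total this takes `n ^ j * n ^ (5 - j) * n ^ 2 = n ^ 7`
steps, up to a constant factor. To verify the running time, the algorithm is written in a small
language of nested loops and first-order formulas, which is compiled to the random access machine;
its programs take time `O(n ^ d)` if loops and quantifiers are nested at most `d` deep
(`RAM.Command.exists_program`).
-/

/-! ### First-order formulas and their evaluation on the random access machine -/

namespace RAM

/-- First-order formulas about a graph whose vertices are linearly ordered. Variables are natural
numbers; a quantifier that stands below `k` other quantifiers (or loops) binds the variable `k`. -/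
inductive Formula where
  | adj (i j : ℕ)
  | lt (i j : ℕ)
  | not (φ : Formula)
  | and (φ ψ : Formula)
  | all (φ : Formula)

namespace Formula

/-- Truth of a formula at level `k`: the variables below `k` are given by `e`. -/
def Realize {V : Type*} [LT V] (G : SimpleGraph V) : Formula → ℕ → (ℕ → V) → Prop
  | adj i j, _, e => G.Adj (e i) (e j)
  | lt i j, _, e => e i < e j
  | not φ, k, e => ¬ φ.Realize G k e
  | and φ ψ, k, e => φ.Realize G k e ∧ ψ.Realize G k e
  | all φ, k, e => ∀ w, φ.Realize G (k + 1) (Function.update e k w)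

/-- At level `k`, the formula has no free variables besides those below `k`. -/
def Closed : Formula → ℕ → Prop
  | adj i j, k => i < k ∧ j < k
  | lt i j, k => i < k ∧ j < k
  | not φ, k => φ.Closed k
  | and φ ψ, k => φ.Closed k ∧ ψ.Closed k
  | all φ, k => φ.Closed (k + 1)

/-- The quantifier depth. -/
def depth : Formula → ℕ
  | adj _ _ => 0
  | lt _ _ => 0
  | not φ => φ.depth
  | and φ ψ => max φ.depth ψ.depth
  | all φ => φ.depth + 1

end Formula

/-! Register `0` holds the number `n` of vertices, register `1` the last truth value, registers
`2` and `3` the constants `1` and `0`; register `4` is scratch space. -/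

/-- The register that holds the variable `i`. -/
abbrev var (i : ℕ) : ℕ := 2 * i + 5

/-- The register that accumulates the truth value of a quantifier that binds the variable `i`. -/
abbrev flag (i : ℕ) : ℕ := 2 * i + 6

/-- The program that runs `p` with the variable `k` set to `0, …, n - 1`. -/
def forEach (k : ℕ) (p : Program) : Program :=
  .seq (.set (var k) (.const 0)) (.seq (.set 1 (.lt (var k) 0))
    (.loop 1 (.seq p (.seq (.set (var k) (.add (var k) 2)) (.set 1 (.lt (var k) 0))))))

/-- The program that evaluates a formula at level `k` and leaves its truth value in register `1`. -/
def Formula.program : Formula → ℕ → Program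
  | .adj i j, _ =>
    .seq (.set 4 (.mul (var i) 0)) (.seq (.set 4 (.add 4 (var j))) (.set 1 (.load 4)))
  | .lt i j, _ => .set 1 (.lt (var i) (var j))
  | .not φ, k => .seq (φ.program k) (.set 1 (.lt 1 2))
  | .and φ ψ, k => .seq (φ.program k) (.ite 1 (ψ.program k) .skip)
  | .all φ, k => .seq (.set (flag k) (.const 1)) (.seq
      (forEach k (.seq (φ.program (k + 1)) (.ite 1 .skip (.set (flag k) (.const 0)))))
      (.set 1 (.lt 3 (flag k))))

/-- An upper bound for the running time of `Formula.program`. -/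
def Formula.cost (n : ℕ) : Formula → ℕ
  | .adj _ _ => 3
  | .lt _ _ => 1
  | .not φ => φ.cost n + 1
  | .and φ ψ => φ.cost n + (ψ.cost n + 2)
  | .all φ => n * (φ.cost n + 5) + 5

/-- The registers below those of the variable `k`, except for `1` and the scratch register `4`, and
the memory are the same in both configurations. -/
structure Agree (k : ℕ) (s s' : State) : Prop where
  mem : s'.mem = s.mem
  reg : ∀ r < var k, r ≠ 1 → r ≠ 4 → s'.reg r = s.reg r

theorem Agree.refl (k : ℕ) (s : State) : Agree k s s := ⟨rfl, fun _ _ _ _ => rfl⟩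

theorem Agree.trans {k : ℕ} {s s' s'' : State} (h : Agree k s s') (h' : Agree k s' s'') :
    Agree k s s'' :=
  ⟨h'.mem.trans h.mem, fun r h₁ h₂ h₃ => (h'.reg r h₁ h₂ h₃).trans (h.reg r h₁ h₂ h₃)⟩

theorem Agree.mono {k k' : ℕ} {s s' : State} (h : Agree k' s s') (hk : k ≤ k') : Agree k s s' :=
  ⟨h.mem, fun r h₁ h₂ h₃ => h.reg r (by simp only [var] at *; omega) h₂ h₃⟩

open Classical in
/-- The configuration `s` holds the input graph `G`, and the values `e` of the variables
below `k`. -/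
structure Ready {n : ℕ} (G : SimpleGraph (Fin n)) (k : ℕ) (e : ℕ → Fin n) (s : State) : Prop where
  size : s.reg 0 = n
  one : s.reg 2 = 1
  zero : s.reg 3 = 0
  var : ∀ i < k, s.reg (var i) = e i
  mem : ∀ i j : Fin n, s.mem (i * n + j) = if G.Adj i j then 1 else 0

theorem Ready.of_agree {n : ℕ} {G : SimpleGraph (Fin n)} {k : ℕ} {e : ℕ → Fin n} {s s' : State}
    (h : Ready G k e s) (h' : Agree k s s') : Ready G k e s' where
  size := by rw [h'.reg 0 (by simp [RAM.var]) (by simp) (by simp), h.size]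
  one := by rw [h'.reg 2 (by simp only [RAM.var]; omega) (by simp) (by simp), h.one]
  zero := by rw [h'.reg 3 (by simp only [RAM.var]; omega) (by simp) (by simp), h.zero]
  var i hi := by
    rw [h'.reg _ (by simp only [RAM.var]; omega) (by simp only [RAM.var]; omega)
      (by simp only [RAM.var]; omega), h.var i hi]
  mem i j := by rw [h'.mem, h.mem]

theorem Operation.eval_lt_le (s : State) (a b : ℕ) : (Operation.lt a b).eval s ≤ 1 := by
  by_cases h : s.reg a < s.reg b <;> simp [Operation.eval, h]

/-- The configuration at the beginning of the pass of `forEach k p` in which variable `k` is `i`. -/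
def State.atPass (n k i : ℕ) (s : State) : State :=
  { s with reg := Function.update (Function.update s.reg (var k) i) 1 (if i < n then 1 else 0) }

/-- A loop over the vertices preserves an invariant that every pass through its body preserves. -/
theorem exec_forEach {B n k T : ℕ} {p : Program} (Inv : ℕ → State → Prop) (hB : n + 2 ≤ B)
    (hInv : ∀ i s, Inv i s → s.reg 1 = if i < n then 1 else 0)
    (hp : ∀ i s, i < n → Inv i s → ∃ t s', Exec B p s t s' ∧ t ≤ T ∧ s'.reg (var k) = i ∧
      s'.reg 0 = n ∧ s'.reg 2 = 1 ∧ Inv (i + 1) (s'.atPass n k (i + 1)))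
    (s : State) (h0 : s.reg 0 = n)
    (hs : Inv 0 (s.atPass n k 0)) :
    ∃ t s', Exec B (forEach k p) s t s' ∧ t ≤ n * (T + 3) + 3 ∧ Inv n s' := by
  have key : ∀ m i s, i + m = n → Inv i s → ∃ t s',
      Exec B (.loop 1 (.seq p (.seq (.set (var k) (.add (var k) 2)) (.set 1 (.lt (var k) 0)))))
        s t s' ∧ t ≤ m * (T + 3) + 1 ∧ Inv n s' := by
    intro m
    induction m with
    | zero =>
      intro i s hi h
      obtain rfl : i = n := by omega
      exact ⟨1, s, .loop_done (by simp [hInv _ _ h]), by omega, h⟩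
    | succ m ih =>
      intro i s hi h
      have hlt : i < n := by omega
      obtain ⟨t, s', he, ht, hk, h0', h2', hI⟩ := hp i s hlt h
      obtain ⟨t', s'', he', ht', hI'⟩ := ih (i + 1) _ (by omega) hI
      refine ⟨(t + (1 + 1)) + t' + 1, s'', .loop_step (by simp [hInv _ _ h, hlt])
        (.seq he (.seq (.set _ _ _ ?_) (.set _ _ _ ?_))) ?_, ?_, hI'⟩
      · simp only [Operation.eval, hk, h2']; omega
      · exact (Operation.eval_lt_le _ _ _).trans_lt (by omega)
      · have h1 : (0 : ℕ) ≠ var k := by simp [var]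
        simpa [State.atPass, Operation.eval, hk, h2', h0', Function.update_of_ne h1] using he'
      · rw [Nat.succ_mul]; omega
  obtain ⟨t, s', he, ht, hI⟩ := key n 0 _ (by omega) hs
  have h1 : (0 : ℕ) ≠ var k := by simp [var]
  refine ⟨1 + (1 + t), s', .seq (.set _ _ _ ?_) (.seq (.set _ _ _ ?_) ?_), by omega, hI⟩
  · simp only [Operation.eval]; omega
  · exact (Operation.eval_lt_le _ _ _).trans_lt (by omega)
  · simpa [State.atPass, Operation.eval, Function.update_of_ne h1, h0] using he

open Classical in
/-- The program of a formula computes its truth value. -/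
theorem Formula.exec_program {n B : ℕ} (G : SimpleGraph (Fin n)) (hB : n * n + n + 2 ≤ B)
    (φ : Formula) (k : ℕ) (hφ : φ.Closed k) (e : ℕ → Fin n) (s : State) (hs : Ready G k e s) :
    ∃ t s', Exec B (φ.program k) s t s' ∧ t ≤ φ.cost n ∧ s'.out = s.out ∧ Agree k s s' ∧
      s'.reg 1 = if φ.Realize G k e then 1 else 0 := by
  induction φ generalizing k e s with
  | adj i j =>
    have hi := hs.var i hφ.1
    have hj := hs.var j hφ.2
    have hlt : (e i : ℕ) * n + e j < n * n := by
      have h1 := (e i).2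
      have h2 := (e j).2
      nlinarith
    have h4 : var j ≠ 4 := by simp only [var]; omega
    refine ⟨1 + (1 + 1), _, .seq (.set _ _ _ ?_) (.seq (.set _ _ _ ?_) (.set _ _ _ ?_)),
      by simp [cost], rfl, ⟨rfl, fun r _ h1 h4 => by simp [h1, h4]⟩, ?_⟩
    · simp only [Operation.eval, hi, hs.size]; omega
    · simp only [Operation.eval, hi, hs.size, Function.update_self, Function.update_of_ne h4, hj]
      omega
    · simp only [Operation.eval, hi, hs.size, Function.update_self, Function.update_of_ne h4, hj,
        hs.mem]
      split_ifs <;> omega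
    · simp only [Operation.eval, hi, hs.size, Function.update_self, Function.update_of_ne h4, hj,
        hs.mem]
      by_cases h : G.Adj (e i) (e j) <;> simp [h, Realize]
  | lt i j =>
    have hi := hs.var i hφ.1
    have hj := hs.var j hφ.2
    refine ⟨1, _, .set _ _ _ ?_, by simp [cost], rfl, ⟨rfl, fun r _ h1 h4 => by simp [h1]⟩, ?_⟩
    · exact (Operation.eval_lt_le _ _ _).trans_lt (by omega)
    · by_cases h : e i < e j
      · simp [Operation.eval, hi, hj, Realize, h, Fin.lt_def.1 h]
      · simp [Operation.eval, hi, hj, Realize, h]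
  | not φ ih =>
    obtain ⟨t, s', he, ht, ho, ha, hr⟩ := ih k hφ e s hs
    have hs' := hs.of_agree ha
    refine ⟨t + 1, _, .seq he (.set _ _ _ ?_), by simp only [cost]; omega, ho,
      ha.trans ⟨rfl, fun r _ h1 h4 => by simp [h1]⟩, ?_⟩
    · exact (Operation.eval_lt_le _ _ _).trans_lt (by omega)
    · by_cases h : φ.Realize G k e <;> simp [Operation.eval, hr, hs'.one, Realize, h]
  | and φ ψ ih ih' =>
    obtain ⟨t, s', he, ht, ho, ha, hr⟩ := ih k hφ.1 e s hs
    by_cases h : φ.Realize G k e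
    · obtain ⟨t', s'', he', ht', ho', ha', hr'⟩ := ih' k hφ.2 e s' (hs.of_agree ha)
      refine ⟨t + (t' + 1), s'', .seq he (.ite_true (by simp [hr, h]) he'),
        by simp only [cost]; omega, ho'.trans ho, ha.trans ha', ?_⟩
      simp [hr', Realize, h]
    · refine ⟨t + (1 + 1), s', .seq he (.ite_false (by simp [hr, h]) (.skip _)),
        by simp only [cost]; omega, ho, ha, ?_⟩
      simp [hr, Realize, h]
  | all φ ih =>
    -- Before the pass for `i`, the flag tells whether `φ` holds for all values below `i`.
    let Inv : ℕ → State → Prop := fun i st =>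
      Agree k s st ∧ st.out = s.out ∧ st.reg (var k) = i ∧ st.reg 1 = (if i < n then 1 else 0) ∧
        st.reg (flag k) = if ∀ w : Fin n, (w : ℕ) < i →
          φ.Realize G (k + 1) (Function.update e k w) then 1 else 0
    have hvk : var k ≠ 1 ∧ var k ≠ 4 ∧ flag k ≠ 1 ∧ flag k ≠ 4 ∧ var k ≠ flag k := by
      simp only [var, flag]; omega
    obtain ⟨h1, h2, h3, h4, h5⟩ := hvk
    have hloop := exec_forEach (B := B) (n := n) (k := k) (T := φ.cost n + 2)
      (p := .seq (φ.program (k + 1)) (.ite 1 .skip (.set (flag k) (.const 0)))) Inv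
      (by omega) (fun i st h => h.2.2.2.1) ?_
      { s with reg := Function.update s.reg (flag k) 1 } ?_ ?_
    · obtain ⟨t, s', he, ht, ha, ho, -, hr, hf⟩ := hloop
      have h0 : s'.reg 3 = 0 := (hs.of_agree ha).zero
      refine ⟨1 + (t + 1), _, .seq (.set _ _ _ ?_) (.seq he (.set _ _ _ ?_)), ?_, ho,
        ha.trans ⟨rfl, fun r _ h1 h4 => by simp [h1]⟩, ?_⟩
      · simp only [Operation.eval]; omega
      · exact (Operation.eval_lt_le _ _ _).trans_lt (by omega)
      · simp only [cost, show φ.cost n + 2 + 3 = φ.cost n + 5 from rfl] at ht ⊢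
        omega
      · simp only [Operation.eval, h0, hf, Realize, Function.update_self]
        have : (∀ w : Fin n, (w : ℕ) < n → φ.Realize G (k + 1) (Function.update e k w)) ↔
          ∀ w, φ.Realize G (k + 1) (Function.update e k w) := ⟨fun h w => h w w.2, fun h w _ => h w⟩
        by_cases h : ∀ w, φ.Realize G (k + 1) (Function.update e k w)
        · simp only [h, implies_true, if_true, Nat.zero_lt_one]
        · simp only [this, h, if_false, lt_self_iff_false]
    · intro i st hi ⟨ha, ho, hk, hr, hf⟩
      have hst : Ready G (k + 1) (Function.update e k ⟨i, hi⟩) st := by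
        have := hs.of_agree ha
        refine ⟨this.size, this.one, this.zero, fun j hj => ?_, this.mem⟩
        rcases Nat.lt_succ_iff_lt_or_eq.1 hj with hj | rfl
        · rw [Function.update_of_ne hj.ne]; exact this.var j hj
        · simpa using hk
      obtain ⟨t, s', he, ht, ho', ha', hr'⟩ := ih (k + 1) hφ _ st hst
      have hst' := hst.of_agree ha'
      have hflag : s'.reg (flag k) = st.reg (flag k) :=
        ha'.reg _ (by simp only [var, flag]; omega) h3 h4
      have hvar : s'.reg (var k) = i := by
        rw [ha'.reg _ (by simp only [var]; omega) h1 h2, hk]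
      have hsucc : (∀ w : Fin n, (w : ℕ) < i + 1 → φ.Realize G (k + 1) (Function.update e k w)) ↔
          (∀ w : Fin n, (w : ℕ) < i → φ.Realize G (k + 1) (Function.update e k w)) ∧
            φ.Realize G (k + 1) (Function.update e k ⟨i, hi⟩) := by
        constructor
        · exact fun h => ⟨fun w hw => h w (by omega), h ⟨i, hi⟩ (by simp)⟩
        · rintro ⟨h, h'⟩ w hw
          rcases Nat.lt_succ_iff_lt_or_eq.1 hw with hw | hw
          · exact h w hw
          · obtain rfl : w = ⟨i, hi⟩ := Fin.ext hw
            exact h'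
      have hag : Agree k st s' := ha'.mono (by omega)
      by_cases h : φ.Realize G (k + 1) (Function.update e k ⟨i, hi⟩)
      · refine ⟨t + (1 + 1), s', .seq he (.ite_true (by simp [hr', h]) (.skip _)), by omega, hvar,
          hst'.size, hst'.one, ⟨?_, ?_, ?_, ?_, ?_⟩⟩
        · refine (ha.trans hag).trans ⟨rfl, fun r hr h1 h4 => ?_⟩
          simp [State.atPass, h1, Nat.ne_of_lt hr]
        · simp [State.atPass, ho', ho]
        · simp [State.atPass, h1]
        · simp [State.atPass]
        · simp only [State.atPass, Function.update_of_ne h3, Function.update_of_ne h5.symm, hflag,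
            hf, hsucc, h, and_true]
      · refine ⟨t + (1 + 1), _, .seq he (.ite_false (by simp [hr', h]) (.set _ _ _ ?_)),
          by omega, ?_, ?_, ?_, ⟨?_, ?_, ?_, ?_, ?_⟩⟩
        · simp only [Operation.eval]; omega
        · simpa [Function.update_of_ne h5] using hvar
        · exact (Function.update_of_ne (show 0 ≠ flag k by simp) 0 s'.reg).trans hst'.size
        · exact (Function.update_of_ne (show 2 ≠ flag k by simp only [flag]; omega) 0
            s'.reg).trans hst'.one
        · refine (ha.trans hag).trans ⟨rfl, fun r hr h1 h4 => ?_⟩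
          have h6 : r ≠ flag k := by simp only [var, flag] at *; omega
          simp [State.atPass, h1, Nat.ne_of_lt hr, h6]
        · simp [State.atPass, ho', ho]
        · simp [State.atPass, h1]
        · simp [State.atPass]
        · simp only [State.atPass, Function.update_of_ne h3, Function.update_of_ne h5.symm,
            Function.update_self, hsucc, h, Operation.eval, and_false, if_false]
    · simp only [flag]
      rw [Function.update_of_ne (by omega)]; exact hs.size
    · refine ⟨⟨rfl, fun r hr h1 h4 => ?_⟩, rfl, ?_, ?_, ?_⟩
      · have h6 : r ≠ flag k := by simp only [var, flag] at *; omega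
        simp [State.atPass, h1, Nat.ne_of_lt hr, h6]
      · simp [State.atPass, h1]
      · simp [State.atPass]
      · simp [State.atPass, Function.update_of_ne h3]

/-- The time to evaluate a formula is of the order given by the quantifier depth. -/
theorem Formula.cost_le (φ : Formula) :
    ∃ C, ∀ m, 1 ≤ m → φ.cost m ≤ C * m ^ φ.depth := by
  induction φ with
  | adj i j => exact ⟨3, fun m _ => by simp [cost, depth]⟩
  | lt i j => exact ⟨1, fun m _ => by simp [cost, depth]⟩
  | not φ ih =>
    obtain ⟨C, hC⟩ := ih
    refine ⟨C + 1, fun m hm => ?_⟩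
    have := hC m hm
    have := Nat.one_le_pow φ.depth m hm
    simp only [cost, depth, add_mul]
    omega
  | and φ ψ ih ih' =>
    obtain ⟨C, hC⟩ := ih
    obtain ⟨C', hC'⟩ := ih'
    refine ⟨C + C' + 2, fun m hm => ?_⟩
    have h1 := (hC m hm).trans
      (Nat.mul_le_mul_left C (Nat.pow_le_pow_right hm (le_max_left φ.depth ψ.depth)))
    have h2 := (hC' m hm).trans
      (Nat.mul_le_mul_left C' (Nat.pow_le_pow_right hm (le_max_right φ.depth ψ.depth)))
    have := Nat.one_le_pow (max φ.depth ψ.depth) m hm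
    simp only [cost, depth, add_mul]
    omega
  | all φ ih =>
    obtain ⟨C, hC⟩ := ih
    refine ⟨C + 10, fun m hm => ?_⟩
    have h1 := Nat.mul_le_mul_left m (hC m hm)
    have h2 := Nat.one_le_pow φ.depth m hm
    simp only [cost, depth, pow_succ]
    nlinarith

/-! ### Commands that write to the output -/

/-- Commands: `put i` writes the variable `i`, `putSize` writes the number of vertices, `test φ c`
executes `c` if `φ` is true, and `each c` executes `c` for every value of the variable `k`, where
`k` is the number of loops around it. -/
inductive Command where
  | skip
  | put (i : ℕ)
  | putSize
  | seq (c d : Command)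
  | test (φ : Formula) (c : Command)
  | each (c : Command)

namespace Command

open Classical in
/-- The words that a command writes. -/
noncomputable def output {n : ℕ} (G : SimpleGraph (Fin n)) : Command → ℕ → (ℕ → Fin n) → List ℕ
  | skip, _, _ => []
  | put i, _, e => [(e i : ℕ)]
  | putSize, _, _ => [n]
  | seq c d, k, e => c.output G k e ++ d.output G k e
  | test φ c, k, e => if φ.Realize G k e then c.output G k e else []
  | each c, k, e => (List.finRange n).flatMap fun w => c.output G (k + 1) (Function.update e k w)

/-- At level `k`, the command has no free variables besides those below `k`. -/
def Closed : Command → ℕ → Prop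
  | skip, _ => True
  | put i, k => i < k
  | putSize, _ => True
  | seq c d, k => c.Closed k ∧ d.Closed k
  | test φ c, k => φ.Closed k ∧ c.Closed k
  | each c, k => c.Closed (k + 1)

/-- The nesting depth of the loops and quantifiers. -/
def depth : Command → ℕ
  | skip => 0
  | put _ => 0
  | putSize => 0
  | seq c d => max c.depth d.depth
  | test φ c => max φ.depth c.depth
  | each c => c.depth + 1

/-- The program of a command at level `k`. -/
def program : Command → ℕ → Program
  | skip, _ => .skip
  | put i, _ => .write (var i)
  | putSize, _ => .write 0
  | seq c d, k => .seq (c.program k) (d.program k)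
  | test φ c, k => .seq (φ.program k) (.ite 1 (c.program k) .skip)
  | each c, k => forEach k (c.program (k + 1))

/-- An upper bound for the running time of `Command.program`. -/
def cost (n : ℕ) : Command → ℕ
  | skip => 1
  | put _ => 1
  | putSize => 1
  | seq c d => c.cost n + d.cost n
  | test φ c => φ.cost n + (c.cost n + 2)
  | each c => n * (c.cost n + 3) + 3

/-- The program of a command writes its output. -/
theorem exec_program {n B : ℕ} (G : SimpleGraph (Fin n)) (hB : n * n + n + 2 ≤ B)
    (c : Command) (k : ℕ) (hc : c.Closed k) (e : ℕ → Fin n) (s : State) (hs : Ready G k e s) :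
    ∃ t s', Exec B (c.program k) s t s' ∧ t ≤ c.cost n ∧ s'.out = s.out ++ c.output G k e ∧
      Agree k s s' := by
  classical
  induction c generalizing k e s with
  | skip => exact ⟨1, s, .skip _, le_rfl, by simp [output], .refl k s⟩
  | put i =>
    exact ⟨1, _, .write _ _, le_rfl, by simp [output, hs.var i hc], ⟨rfl, fun _ _ _ _ => rfl⟩⟩
  | putSize =>
    exact ⟨1, _, .write _ _, le_rfl, by simp [output, hs.size], ⟨rfl, fun _ _ _ _ => rfl⟩⟩
  | seq c d ih ih' =>
    obtain ⟨t, s', he, ht, ho, ha⟩ := ih k hc.1 e s hs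
    obtain ⟨t', s'', he', ht', ho', ha'⟩ := ih' k hc.2 e s' (hs.of_agree ha)
    exact ⟨t + t', s'', .seq he he', add_le_add ht ht', by simp [output, ho, ho'], ha.trans ha'⟩
  | test φ c ih =>
    obtain ⟨t, s', he, ht, ho, ha, hr⟩ := φ.exec_program G hB k hc.1 e s hs
    by_cases h : φ.Realize G k e
    · obtain ⟨t', s'', he', ht', ho', ha'⟩ := ih k hc.2 e s' (hs.of_agree ha)
      exact ⟨t + (t' + 1), s'', .seq he (.ite_true (by simp [hr, h]) he'),
        by simp only [cost]; omega, by simp [output, ho, ho', h], ha.trans ha'⟩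
    · exact ⟨t + (1 + 1), s', .seq he (.ite_false (by simp [hr, h]) (.skip _)),
        by simp only [cost]; omega, by simp [output, ho, h], ha⟩
  | each c ih =>
    -- Before the pass for `i`, the outputs for all values below `i` have been written.
    let Inv : ℕ → State → Prop := fun i st =>
      Agree k s st ∧ st.reg (var k) = i ∧ st.reg 1 = (if i < n then 1 else 0) ∧
        st.out = s.out ++ ((List.finRange n).take i).flatMap fun w =>
          c.output G (k + 1) (Function.update e k w)
    have hvk : var k ≠ 1 ∧ var k ≠ 4 := by simp only [var]; omega
    obtain ⟨h1, h2⟩ := hvk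
    have hpass : ∀ i st, Agree k s st → Agree k s (st.atPass n k i) := fun i st h =>
      h.trans ⟨rfl, fun r hr h1 h4 => by simp [State.atPass, h1, Nat.ne_of_lt hr]⟩
    have hloop := exec_forEach (B := B) (n := n) (k := k) (T := c.cost n)
      (p := c.program (k + 1)) Inv (by omega) (fun i st h => h.2.2.1) ?_ s hs.size
      ⟨hpass 0 s (.refl k s), by simp [State.atPass, h1], by simp [State.atPass],
        by simp [State.atPass]⟩
    · obtain ⟨t, s', he, ht, ha, -, -, ho⟩ := hloop
      exact ⟨t, s', he, ht, by
        rw [ho, List.take_of_length_le (by simp), output], ha⟩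
    · intro i st hi ⟨ha, hk, hr, ho⟩
      have hst : Ready G (k + 1) (Function.update e k ⟨i, hi⟩) st := by
        have := hs.of_agree ha
        refine ⟨this.size, this.one, this.zero, fun j hj => ?_, this.mem⟩
        rcases Nat.lt_succ_iff_lt_or_eq.1 hj with hj | rfl
        · rw [Function.update_of_ne hj.ne]; exact this.var j hj
        · simpa using hk
      obtain ⟨t, s', he, ht, ho', ha'⟩ := ih (k + 1) hc _ st hst
      have hst' := hst.of_agree ha'
      have hag : Agree k st s' := ha'.mono (by omega)
      refine ⟨t, s', he, ht, ?_, hst'.size, hst'.one, hpass _ _ (ha.trans hag),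
        by simp [State.atPass, h1], by simp [State.atPass], ?_⟩
      · rw [ha'.reg _ (by simp only [var]; omega) h1 h2, hk]
      · have hlen : i < (List.finRange n).length := by simpa using hi
        simp [State.atPass, ho', ho, List.take_succ_eq_append_getElem hlen]

/-- The running time is of the order given by the nesting depth. -/
theorem cost_le (c : Command) : ∃ C, ∀ m, 1 ≤ m → c.cost m ≤ C * m ^ c.depth := by
  induction c with
  | skip => exact ⟨1, fun m _ => by simp [cost, depth]⟩
  | put i => exact ⟨1, fun m _ => by simp [cost, depth]⟩
  | putSize =>
    exact ⟨1, fun m _ => by simp [cost, depth]⟩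
  | seq c d ih ih' =>
    obtain ⟨C, hC⟩ := ih
    obtain ⟨C', hC'⟩ := ih'
    refine ⟨C + C', fun m hm => ?_⟩
    have h1 := (hC m hm).trans
      (Nat.mul_le_mul_left C (Nat.pow_le_pow_right hm (le_max_left c.depth d.depth)))
    have h2 := (hC' m hm).trans
      (Nat.mul_le_mul_left C' (Nat.pow_le_pow_right hm (le_max_right c.depth d.depth)))
    simp only [cost, depth, add_mul]
    omega
  | test φ c ih =>
    obtain ⟨C, hC⟩ := φ.cost_le
    obtain ⟨C', hC'⟩ := ih
    refine ⟨C + C' + 2, fun m hm => ?_⟩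
    have h1 := (hC m hm).trans
      (Nat.mul_le_mul_left C (Nat.pow_le_pow_right hm (le_max_left φ.depth c.depth)))
    have h2 := (hC' m hm).trans
      (Nat.mul_le_mul_left C' (Nat.pow_le_pow_right hm (le_max_right φ.depth c.depth)))
    have := Nat.one_le_pow (max φ.depth c.depth) m hm
    simp only [cost, depth, add_mul]
    omega
  | each c ih =>
    obtain ⟨C, hC⟩ := ih
    refine ⟨C + 6, fun m hm => ?_⟩
    have h1 := Nat.mul_le_mul_left m (hC m hm)
    have h2 := Nat.one_le_pow c.depth m hm
    simp only [cost, depth, pow_succ]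
    nlinarith

/-- A closed command whose loops and quantifiers are nested at most `d` deep has a program that
writes its output in time `O(n ^ d)`, with words of polynomial size. -/
theorem exists_program (c : Command) (hc : c.Closed 0) {d : ℕ} (hd : c.depth ≤ d) (hd2 : 2 ≤ d) :
    ∃ (p : Program) (C : ℕ), ∀ (n : ℕ), 1 ≤ n → ∀ (G : SimpleGraph (Fin n)) (e : ℕ → Fin n),
      ∃ (t : ℕ) (s : State), Exec (C * n ^ d) p (input G) t s ∧ t ≤ C * n ^ d ∧
        s.out = c.output G 0 e := by
  classical
  obtain ⟨C, hC⟩ := c.cost_le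
  refine ⟨.seq (.set 2 (.const 1)) (c.program 0), C + 4, fun n hn G e => ?_⟩
  have h1 : n ^ 2 ≤ n ^ d := Nat.pow_le_pow_right hn hd2
  have h2 : n ≤ n ^ 2 := Nat.le_self_pow (by simp) n
  have hB : n * n + n + 2 ≤ (C + 4) * n ^ d := by nlinarith [Nat.zero_le (C * n ^ d)]
  have hready : Ready G 0 e
      { input G with
        reg := Function.update (input G).reg 2 ((Operation.const 1).eval (input G)) } := by
    refine ⟨by simp [input], by simp [Operation.eval], by simp [input], by simp, fun i j => ?_⟩
    have : (∃ i' j' : Fin n, (i : ℕ) * n + j = i' * n + j' ∧ G.Adj i' j') ↔ G.Adj i j := by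
      refine ⟨fun ⟨i', j', h, h'⟩ => ?_, fun h => ⟨i, j, rfl, h⟩⟩
      have hj : (j : ℕ) = j' := by
        have := congrArg (· % n) h
        simpa [Nat.mul_add_mod_of_lt, Nat.mod_eq_of_lt] using this
      have hi : (i : ℕ) = i' := Nat.eq_of_mul_eq_mul_right hn (by omega)
      rwa [Fin.ext hi, Fin.ext hj]
    simp only [input, this]
  obtain ⟨t, s, he, ht, ho, -⟩ := exec_program G hB c 0 hc e _ hready
  refine ⟨1 + t, s, .seq (.set _ _ _ ?_) he, ?_, by simpa [input] using ho⟩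
  · simp only [Operation.eval]; omega
  · have := hC n hn
    have := Nat.mul_le_mul_left C (Nat.pow_le_pow_right hn hd)
    have := Nat.one_le_pow d n hn
    rw [add_mul]
    omega

end Command

end RAM

/-! ### Shapes of sets of cherries -/

/-- `{a, b} = {p, q}` as unordered pairs. -/
def IsPair {V : Type*} (p q a b : V) : Prop := (a = p ∧ b = q) ∨ (a = q ∧ b = p)

/-- The cherry with center `c` and ends `a`, `b` has the edge `{p, q}`. -/
def OnEdge {V : Type*} (p q c a b : V) : Prop :=
  (c = p ∧ (a = q ∨ b = q)) ∨ (c = q ∧ (a = p ∨ b = p))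

/-- All cherries with center `u` or with one of the edges `{u, v}`, `{u, z}`, and the cherries
`v - x - u` and `u - y - z`. -/
def StarShape {V : Type*} (u v z x y c a b : V) : Prop :=
  c = u ∨ OnEdge u v c a b ∨ OnEdge u z c a b ∨ (c = x ∧ IsPair u v a b) ∨ (c = y ∧ IsPair u z a b)

/-- All cherries with one of the edges `{u, v}`, `{u, z}`, all cherries with center `v` and edge
`{v, z}`, and the cherries `u - x - v` and `v - x - z`. -/
def FanShape {V : Type*} (u v z x c a b : V) : Prop :=
  OnEdge u v c a b ∨ OnEdge u z c a b ∨ (c = v ∧ (a = z ∨ b = z)) ∨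
    (c = x ∧ (IsPair u v a b ∨ IsPair v z a b))

/-- All cherries with one of the edges `{u, v}`, `{u, z}`, all cherries with center `u` and edge
`{u, x}`, and the cherries `x - v - z`, `u - x - v` and `v - x - z`. -/
def KiteShape {V : Type*} (u v z x c a b : V) : Prop :=
  OnEdge u v c a b ∨ OnEdge u z c a b ∨ (c = u ∧ (a = x ∨ b = x)) ∨ (c = v ∧ IsPair x z a b) ∨
    (c = x ∧ (IsPair u v a b ∨ IsPair v z a b))

/-- All cherries with one of the edges `{u, v}`, `{u, z}`, and all cherries on the four vertices
`u`, `v`, `z`, `x`. -/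
def TetraShape {V : Type*} (u v z x c a b : V) : Prop :=
  OnEdge u v c a b ∨ OnEdge u z c a b ∨
    ((c = u ∨ c = v ∨ c = z ∨ c = x) ∧ (a = u ∨ a = v ∨ a = z ∨ a = x) ∧
      (b = u ∨ b = v ∨ b = z ∨ b = x))

/-- The cherries in `Q` are the pairs of comparable elements in an interval order of all edges: the
edge `{p, q}` corresponds to the interval from `l p q` to `r p q`. -/
def IsIntervalOrderSet {V : Type*} (Q : V → V → V → Prop) : Prop :=
  ∃ l r : V → V → ℤ, (∀ p q, l p q = l q p ∧ r p q = r q p ∧ (p ≠ q → l p q ≤ r p q)) ∧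
    (∀ c a b, a ≠ b → c ≠ a → c ≠ b → (Q c a b ↔ r c a < l c b ∨ r c b < l c a)) ∧
    ∀ p q p' q', p ≠ q → p' ≠ q' → r p q < l p' q' → p = p' ∨ p = q' ∨ q = p' ∨ q = q'

/-- The shape is an interval order also if some of the vertices are left out, that is, replaced
by `u`. -/
theorem isIntervalOrderSet_starShape {V : Type*} [Finite V] {u v z x y : V}
    (hvz : v = z → v = u) (hvx : v = x → v = u) (hvy : v = y → v = u)
    (hzx : z = x → z = u) (hzy : z = y → z = u) (hxy : x = y → x = u) :
    IsIntervalOrderSet (StarShape u v z x y) := by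
  classical
  obtain ⟨N, ⟨f⟩⟩ := Finite.exists_equiv_fin V
  obtain ⟨g, hg, hg0, hgN⟩ : ∃ g : V → ℤ, (∀ a b, g a = g b → a = b) ∧ (∀ a, 2 ≤ g a) ∧
      ∀ a, g a ≤ N + 1 := by
    refine ⟨fun a => (f a : ℕ) + 2, fun a b h => ?_, fun a => by simp, fun a => ?_⟩
    · apply f.injective; ext; simpa using h
    · have := (f a).2; dsimp only; omega
  -- The edges at `u` are points, with `v`, `x` first and `y`, `z` last. The intervals of the other
  -- edges contain all of these points, except that those at `v` start right of `{u, v}`, those at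
  -- `z` end left of `{u, z}`, and `{v, x}`, `{z, y}` leave out one more point.
  let rk : V → ℤ := fun w =>
    if w = v then 0 else if w = x then 1 else if w = z then N + 3 else if w = y then N + 2 else g w
  refine ⟨fun p q => if p = u then 2 * rk q else if q = u then 2 * rk p else
      if IsPair v x p q then 3 else if p = v ∨ q = v then 1 else -1,
    fun p q => if p = u then 2 * rk q else if q = u then 2 * rk p else
      if IsPair z y p q then 2 * N + 3 else if p = z ∨ q = z then 2 * N + 5 else 2 * N + 7,
    ?_, ?_, ?_⟩
  · intro p q; simp only [rk, IsPair]; grind (splits := 40)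
  · intro c a b h₁ h₂ h₃; simp only [StarShape, OnEdge, rk, IsPair]
    constructor <;> grind (splits := 40)
  · intro p q p' q'; simp only [rk, IsPair]; grind (splits := 40)

/-- The vertex `x` may be left out, that is, replaced by `u`. -/
theorem isIntervalOrderSet_fanShape {V : Type*} {u v z x : V} (huv : u ≠ v) (huz : u ≠ z)
    (hvz : v ≠ z) (hvx : v ≠ x) (hzx : z ≠ x) : IsIntervalOrderSet (FanShape u v z x) := by
  classical
  refine ⟨fun p q => if IsPair u v p q then 0 else if IsPair u z p q then 6 else
      if IsPair v z p q then 1 else if IsPair v x p q ∧ x ≠ u then 4 else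
      if p = v ∨ q = v then 3 else if p = u ∨ q = u then 1 else -1,
    fun p q => if IsPair u v p q then 0 else if IsPair u z p q then 6 else
      if IsPair v z p q then 2 else if IsPair u x p q ∨ (IsPair z x p q ∧ x ≠ u) then 3 else
      if p = u ∨ q = u ∨ p = z ∨ q = z then 5 else 7, ?_, ?_, ?_⟩
  · intro p q; simp only [IsPair]; grind
  · intro c a b h₁ h₂ h₃; simp only [FanShape, OnEdge, IsPair]
    constructor <;> grind (splits := 40)
  · intro p q p' q'; simp only [IsPair]; grind (splits := 40)

theorem isIntervalOrderSet_kiteShape {V : Type*} {u v z x : V} (huv : u ≠ v) (huz : u ≠ z)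
    (hvz : v ≠ z) (hux : u ≠ x) (hvx : v ≠ x) (hzx : z ≠ x) :
    IsIntervalOrderSet (KiteShape u v z x) := by
  classical
  refine ⟨fun p q => if IsPair u v p q then 0 else if IsPair u z p q then 8 else
      if IsPair u x p q then 2 else if IsPair v x p q then 5 else if p = u ∨ q = u then 3 else
      if p = v ∨ q = v then 1 else -1,
    fun p q => if IsPair u v p q then 0 else if IsPair u z p q then 8 else
      if IsPair u x p q then 2 else if IsPair z x p q ∨ IsPair v z p q then 4 else
      if p = u ∨ q = u then 7 else if p = z ∨ q = z then 7 else 9, ?_, ?_, ?_⟩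
  · intro p q; simp only [IsPair]; grind
  · intro c a b h₁ h₂ h₃; simp only [KiteShape, OnEdge, IsPair]
    constructor <;> grind (splits := 40)
  · intro p q p' q'; simp only [IsPair]; grind (splits := 40)

theorem isIntervalOrderSet_tetraShape {V : Type*} {u v z x : V} (huv : u ≠ v) (huz : u ≠ z)
    (hvz : v ≠ z) (hux : u ≠ x) (hvx : v ≠ x) (hzx : z ≠ x) :
    IsIntervalOrderSet (TetraShape u v z x) := by
  classical
  refine ⟨fun p q => if IsPair u v p q then 0 else if IsPair u z p q then 8 else
      if IsPair u x p q ∨ IsPair v z p q then 4 else if IsPair v x p q then 6 else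
      if p = u ∨ q = u ∨ p = v ∨ q = v then 1 else -1,
    fun p q => if IsPair u v p q then 0 else if IsPair u z p q then 8 else
      if IsPair u x p q ∨ IsPair v z p q then 4 else if IsPair z x p q then 2 else
      if p = u ∨ q = u ∨ p = z ∨ q = z then 7 else 9, ?_, ?_, ?_⟩
  · intro p q; simp only [IsPair]; grind
  · intro c a b h₁ h₂ h₃; simp only [TetraShape, OnEdge, IsPair]
    constructor <;> grind (splits := 40)
  · intro p q p' q'; simp only [IsPair]; grind (splits := 40)

/-! ### Covering an interval order of the edges by a shape -/

/-- The edges `{p, q}` and `{p', q'}` have exactly one common end. -/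
def ShareEnd {V : Type*} (p q p' q' : V) : Prop :=
  (p = p' ∧ q ≠ q') ∨ (p = q' ∧ q ≠ p') ∨ (q = p' ∧ p ≠ q') ∨ (q = q' ∧ p ≠ p')

/-- An interval order on the edges of `G` in which only edges with a common end are comparable:
the edge `{p, q}` corresponds to the interval from `l p q` to `r p q`. -/
structure IsEdgeOrder {V : Type*} (G : SimpleGraph V) (l r : V → V → ℝ) : Prop where
  symm_left : ∀ p q, l p q = l q p
  symm_right : ∀ p q, r p q = r q p
  share : ∀ p q p' q', G.Adj p q → G.Adj p' q' → r p q < l p' q' → ShareEnd p q p' q'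

theorem IsPair.swap {V : Type*} {p q a b : V} (h : IsPair p q a b) : IsPair p q b a :=
  h.elim (fun h => .inr h.symm) (fun h => .inl h.symm)

/-- The set `Q` contains all cherries that consist of comparable edges. -/
def Covers {V : Type*} (G : SimpleGraph V) (l r : V → V → ℝ) (Q : V → V → V → Prop) : Prop :=
  ∀ c a b, G.Adj c a → G.Adj c b → r c a < l c b → Q c a b

/-- Among the edges with some property, one minimizes `f`. -/
theorem exists_adj_minimizing {V : Type*} [Finite V] {G : SimpleGraph V} (f : V → V → ℝ)
    (P : V → V → Prop) (h : ∃ p q, G.Adj p q ∧ P p q) :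
    ∃ p q, G.Adj p q ∧ P p q ∧ ∀ p' q', G.Adj p' q' → P p' q' → f p q ≤ f p' q' := by
  obtain ⟨p, q, hpq⟩ := h
  obtain ⟨⟨p, q⟩, ⟨hm, hP⟩, hmin⟩ := (Set.toFinite {w : V × V | G.Adj w.1 w.2 ∧ P w.1 w.2})
    |>.exists_minimalFor (fun w => f w.1 w.2) _ ⟨(p, q), hpq⟩
  refine ⟨p, q, hm, hP, fun p' q' h h' => ?_⟩
  exact (le_total (f p q) (f p' q')).elim id fun hle => hmin (j := (p', q')) ⟨h, h'⟩ hle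

set_option maxHeartbeats 800000 in
/-- Every interval order of the edges in which only edges with a common end are comparable is
contained in one of the shapes. The vertices `u`, `v`, `z` come from the edge `{u, v}` with the
leftmost right end and the edge `{u, z}` with the rightmost left end; the others come from the
runners-up. -/
theorem IsEdgeOrder.exists_covers {V : Type*} [Finite V] {G : SimpleGraph V} {l r : V → V → ℝ}
    (h : IsEdgeOrder G l r) (hne : ∃ c a b, G.Adj c a ∧ G.Adj c b ∧ r c a < l c b) :
    ∃ u v z, v ≠ z ∧ G.Adj u v ∧ G.Adj u z ∧
      (Covers G l r (fun c a b => OnEdge u v c a b ∨ OnEdge u z c a b) ∨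
      (∃ x y, G.Adj u x ∧ G.Adj u y ∧ x ≠ y ∧ x ≠ v ∧ x ≠ z ∧ y ≠ v ∧ y ≠ z ∧
        Covers G l r (StarShape u v z x y)) ∨
      (∃ x, G.Adj u x ∧ G.Adj v x ∧ x ≠ z ∧ Covers G l r (KiteShape u v z x)) ∨
      (∃ x, G.Adj u x ∧ G.Adj z x ∧ x ≠ v ∧ Covers G l r (KiteShape u z v x)) ∨
      (∃ x, G.Adj z x ∧ G.Adj v x ∧ x ≠ u ∧ Covers G l r (TetraShape u v z x)) ∨
      (∃ x, G.Adj v z ∧ G.Adj v x ∧ x ≠ u ∧ x ≠ z ∧ Covers G l r (FanShape u v z x)) ∨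
      (∃ x, G.Adj v z ∧ G.Adj z x ∧ x ≠ u ∧ x ≠ v ∧ Covers G l r (FanShape u z v x))) := by
  obtain ⟨c₀, a₀, b₀, hca₀, hcb₀, hlt₀⟩ := hne
  obtain ⟨p, q, hpq, -, hmin₀⟩ := exists_adj_minimizing (G := G) r (fun _ _ => True)
    ⟨c₀, a₀, hca₀, trivial⟩
  obtain ⟨p', q', hpq', -, hmax₀⟩ := exists_adj_minimizing (G := G) (fun p q => - l p q)
    (fun _ _ => True) ⟨c₀, a₀, hca₀, trivial⟩
  have hlt : r p q < l p' q' := by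
    linarith [hmin₀ _ _ hca₀ trivial, hmax₀ _ _ hcb₀ trivial]
  -- The edge with the leftmost right end and the one with the rightmost left end are comparable,
  -- and therefore they have a common end `u`.
  obtain ⟨u, v, z, huv, huz, hvz, hmin, hmax⟩ : ∃ u v z, G.Adj u v ∧ G.Adj u z ∧ v ≠ z ∧
      (∀ a b, G.Adj a b → r u v ≤ r a b) ∧ (∀ a b, G.Adj a b → l a b ≤ l u z) := by
    have hmin' := fun a b hab => hmin₀ a b hab trivial
    have hmax' : ∀ a b, G.Adj a b → l a b ≤ l p' q' :=
      fun a b hab => neg_le_neg_iff.1 (hmax₀ a b hab trivial)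
    rcases h.share _ _ _ _ hpq hpq' hlt with ⟨rfl, hn⟩ | ⟨rfl, hn⟩ | ⟨rfl, hn⟩ | ⟨rfl, hn⟩
    · exact ⟨p, q, q', hpq, hpq', hn, hmin', hmax'⟩
    · exact ⟨p, q, p', hpq, hpq'.symm, hn, hmin', h.symm_left p p' ▸ hmax'⟩
    · exact ⟨q, p, q', hpq.symm, hpq', hn, h.symm_right q p ▸ hmin', hmax'⟩
    · exact ⟨q, p, p', hpq.symm, hpq'.symm, hn, h.symm_right q p ▸ hmin', h.symm_left q p' ▸ hmax'⟩
  clear hmin₀ hmax₀ hlt hpq hpq' p q p' q' hlt₀ hca₀ hcb₀ c₀ a₀ b₀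
  refine ⟨u, v, z, hvz, huv, huz, ?_⟩
  -- In every comparable pair, the right edge is comparable to `{u, v}`, and the left edge to
  -- `{u, z}`.
  have key : ∀ c a b, G.Adj c a → G.Adj c b → r c a < l c b →
      ShareEnd u v c b ∧ ShareEnd c a u z := fun c a b hca hcb hlt =>
    ⟨h.share _ _ _ _ huv hcb ((hmin _ _ hca).trans_lt hlt),
      h.share _ _ _ _ hca huz (hlt.trans_le (hmax _ _ hcb))⟩
  by_cases hM : ∃ c a b, G.Adj c a ∧ G.Adj c b ∧ r c a < l c b ∧ ¬ IsPair u v c a ∧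
      ¬ IsPair u z c b
  swap
  · left
    intro c a b hca hcb hlt
    have := not_exists.1 (not_exists.1 (not_exists.1 hM c) a) b
    simp only [OnEdge, IsPair] at *
    grind
  right
  obtain ⟨c₀, a₀, b₀, hca₀, hcb₀, hlt₀, hn₀, hn₀'⟩ := hM
  -- The runners-up `{p, q}` and `{p', q'}` are comparable, too, and each of them is comparable to
  -- one of the two extreme edges, which determines their position up to a few cases.
  obtain ⟨p, q, hpq, hpqn, hmin₂⟩ := exists_adj_minimizing (G := G) r
    (fun p q => ¬ IsPair u v p q) ⟨c₀, a₀, hca₀, hn₀⟩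
  obtain ⟨p', q', hpq', hpqn', hmax₂⟩ := exists_adj_minimizing (G := G) (fun p q => - l p q)
    (fun p q => ¬ IsPair u z p q) ⟨c₀, b₀, hcb₀, hn₀'⟩
  have hmax₂ : ∀ a b, G.Adj a b → ¬ IsPair u z a b → l a b ≤ l p' q' :=
    fun a b hab hn => neg_le_neg_iff.1 (hmax₂ a b hab hn)
  have hlt : r p q < l p' q' :=
    ((hmin₂ _ _ hca₀ hn₀).trans_lt hlt₀).trans_le (hmax₂ _ _ hcb₀ hn₀')
  have hlt₁ : r p q < l u z := hlt.trans_le (hmax _ _ hpq')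
  have hlt₂ : r u v < l p' q' := (hmin _ _ hpq).trans_lt hlt
  obtain ⟨p, q, hpq, hpqn, hmin₂, hlt, hx⟩ : ∃ p q, G.Adj p q ∧ ¬ IsPair u v p q ∧
      (∀ a b, G.Adj a b → ¬ IsPair u v a b → r p q ≤ r a b) ∧ r p q < l p' q' ∧
      ((p = u ∧ q ≠ z) ∨ (p = z ∧ q ≠ u)) := by
    have hs := h.symm_right p q
    rcases h.share _ _ _ _ hpq huz hlt₁ with hn | hn | hn | hn
    · exact ⟨p, q, hpq, hpqn, hmin₂, hlt, .inl hn⟩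
    · exact ⟨p, q, hpq, hpqn, hmin₂, hlt, .inr hn⟩
    · exact ⟨q, p, hpq.symm, fun hp => hpqn hp.swap, hs ▸ hmin₂,
        hs ▸ hlt, .inl hn⟩
    · exact ⟨q, p, hpq.symm, fun hp => hpqn hp.swap, hs ▸ hmin₂,
        hs ▸ hlt, .inr hn⟩
  obtain ⟨p', q', hpq', hpqn', hmax₂, hlt, hy⟩ : ∃ p' q', G.Adj p' q' ∧ ¬ IsPair u z p' q' ∧
      (∀ a b, G.Adj a b → ¬ IsPair u z a b → l a b ≤ l p' q') ∧ r p q < l p' q' ∧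
      ((p' = u ∧ q' ≠ v) ∨ (p' = v ∧ q' ≠ u)) := by
    have hs := h.symm_left p' q'
    rcases h.share _ _ _ _ huv hpq' hlt₂ with hn | hn | hn | hn
    · exact ⟨p', q', hpq', hpqn', hmax₂, hlt, .inl ⟨hn.1.symm, hn.2.symm⟩⟩
    · exact ⟨q', p', hpq'.symm, fun hp => hpqn' hp.swap, hs ▸ hmax₂,
        hs ▸ hlt, .inl ⟨hn.1.symm, hn.2.symm⟩⟩
    · exact ⟨p', q', hpq', hpqn', hmax₂, hlt, .inr ⟨hn.1.symm, hn.2.symm⟩⟩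
    · exact ⟨q', p', hpq'.symm, fun hp => hpqn' hp.swap, hs ▸ hmax₂,
        hs ▸ hlt, .inr ⟨hn.1.symm, hn.2.symm⟩⟩
  have key₂ : ∀ c a b, G.Adj c a → G.Adj c b → r c a < l c b →
      (IsPair u v c a ∨ ShareEnd p q c b) ∧ (IsPair u z c b ∨ ShareEnd c a p' q') := by
    intro c a b hca hcb hlt'
    refine ⟨or_iff_not_imp_left.2 fun hn => ?_, or_iff_not_imp_left.2 fun hn => ?_⟩
    · exact h.share _ _ _ _ hpq hcb ((hmin₂ _ _ hca hn).trans_lt hlt')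
    · exact h.share _ _ _ _ hca hpq' (hlt'.trans_le (hmax₂ _ _ hcb hn))
  have hsh := h.share _ _ _ _ hpq hpq' hlt
  have hne₁ := huv.ne
  have hne₂ := huz.ne
  have hne₃ := hpq.ne
  have hne₄ := hpq'.ne
  have key : ∀ c a b, G.Adj c a → G.Adj c b → r c a < l c b →
      ((ShareEnd u v c b ∧ ShareEnd c a u z) ∧
      (IsPair u v c a ∨ ShareEnd p q c b) ∧ (IsPair u z c b ∨ ShareEnd c a p' q')) ∧
      c ≠ a ∧ c ≠ b ∧ ShareEnd c a c b := fun c a b hca hcb hlt =>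
    ⟨⟨key c a b hca hcb hlt, key₂ c a b hca hcb hlt⟩, hca.ne, hcb.ne, h.share _ _ _ _ hca hcb hlt⟩
  clear * - key hx hy hsh hne₁ hne₂ hne₃ hne₄ hvz hpqn hpqn' hpq hpq'
  simp only [IsPair, ShareEnd, Covers] at *
  rcases hx with ⟨rfl, hx⟩ | ⟨rfl, hx⟩ <;> rcases hy with ⟨rfl, hy⟩ | ⟨rfl, hy⟩
  · refine .inl ⟨q, q', hpq, hpq', by grind, by grind, hx, hy, by grind, ?_⟩
    intro c a b hca hcb hlt
    have hc := key c a b hca hcb hlt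
    clear hca hcb hlt key
    simp only [StarShape, OnEdge, IsPair]
    grind (splits := 30)
  · obtain rfl : q = q' := by grind
    refine .inr (.inl ⟨q, hpq, hpq', hx, ?_⟩)
    intro c a b hca hcb hlt
    have hc := key c a b hca hcb hlt
    clear hca hcb hlt key
    simp only [KiteShape, OnEdge, IsPair]
    grind (splits := 30)
  · obtain rfl : q = q' := by grind
    refine .inr (.inr (.inl ⟨q, hpq', hpq, hy, ?_⟩))
    intro c a b hca hcb hlt
    have hc := key c a b hca hcb hlt
    clear hca hcb hlt key
    simp only [KiteShape, OnEdge, IsPair]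
    grind (splits := 30)
  · rcases (by grind : q = q' ∨ (q = p' ∧ q' ≠ p) ∨ (q' = p ∧ q ≠ p')) with
      rfl | ⟨rfl, hn⟩ | ⟨rfl, hn⟩
    · refine .inr (.inr (.inr (.inl ⟨q, hpq, hpq', hx, ?_⟩)))
      intro c a b hca hcb hlt
      have hc := key c a b hca hcb hlt
      clear hca hcb hlt key
      simp only [TetraShape, OnEdge]
      grind (splits := 30)
    · refine .inr (.inr (.inr (.inr (.inl ⟨q', hpq.symm, hpq', hy, hn, ?_⟩))))
      intro c a b hca hcb hlt
      have hc := key c a b hca hcb hlt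
      clear hca hcb hlt key
      simp only [FanShape, OnEdge, IsPair]
      grind (splits := 30)
    · refine .inr (.inr (.inr (.inr (.inr ⟨q, hpq', hpq, hx, hn, ?_⟩))))
      intro c a b hca hcb hlt
      have hc := key c a b hca hcb hlt
      clear hca hcb hlt key
      simp only [FanShape, OnEdge, IsPair]
      grind (splits := 30)

/-! ### The shapes with their parameters -/

/-- The kinds of shapes. Those derived from `StarShape` and `FanShape` leave out some of the
vertices, and the subscript counts those that remain. -/
inductive Shape where
  | empty
  | star₁
  | star₂
  | star₃
  | star₃'
  | star₄
  | star₅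
  | fan₃
  | fan₄
  | kite
  | tetra

instance : Inhabited Shape := ⟨.empty⟩

namespace Shape

variable {V : Type*}

/-- The number of vertices on which a shape depends. -/
def arity : Shape → ℕ
  | empty => 0
  | star₁ => 1
  | star₂ => 2
  | star₃ => 3
  | star₃' => 3
  | star₄ => 4
  | star₅ => 5
  | fan₃ => 3
  | fan₄ => 4
  | kite => 4
  | tetra => 4

/-- The cherries of the shape with parameters `s`, of which only the first `arity` matter. A vertex
that is left out is replaced by `s 0`. -/
def Contains (s : Fin 5 → V) : Shape → V → V → V → Prop
  | empty => fun _ _ _ => False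
  | star₁ => StarShape (s 0) (s 0) (s 0) (s 0) (s 0)
  | star₂ => StarShape (s 0) (s 1) (s 0) (s 0) (s 0)
  | star₃ => StarShape (s 0) (s 1) (s 0) (s 2) (s 0)
  | star₃' => StarShape (s 0) (s 1) (s 2) (s 0) (s 0)
  | star₄ => StarShape (s 0) (s 1) (s 2) (s 3) (s 0)
  | star₅ => StarShape (s 0) (s 1) (s 2) (s 3) (s 4)
  | fan₃ => FanShape (s 0) (s 1) (s 2) (s 0)
  | fan₄ => FanShape (s 0) (s 1) (s 2) (s 3)
  | kite => KiteShape (s 0) (s 1) (s 2) (s 3)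
  | tetra => TetraShape (s 0) (s 1) (s 2) (s 3)

/-- The parameters that matter are distinct. -/
def Distinct (t : Shape) (s : Fin 5 → V) : Prop :=
  ∀ i j : Fin 5, i < j → (j : ℕ) < t.arity → s i ≠ s j

/-- The cherries of `G` in a shape. -/
def Cherry (G : SimpleGraph V) (t : Shape) (s : Fin 5 → V) (c a b : V) : Prop :=
  G.Adj c a ∧ G.Adj c b ∧ a ≠ b ∧ t.Contains s c a b

/-- The parameters are distinct, and each of them is the center of a cherry of `G` in the shape. -/
def IsCandidate (G : SimpleGraph V) (t : Shape) (s : Fin 5 → V) : Prop :=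
  t.Distinct s ∧ ∀ i : Fin 5, (i : ℕ) < t.arity → ∃ a b, t.Cherry G s (s i) a b

theorem contains_swap (t : Shape) {s : Fin 5 → V} {c a b : V} (h : t.Contains s c a b) :
    t.Contains s c b a := by
  cases t <;>
    simp only [Contains, StarShape, FanShape, KiteShape, TetraShape, OnEdge, IsPair] at * <;> grind

theorem contains_congr (t : Shape) {s s' : Fin 5 → V}
    (h : ∀ i : Fin 5, (i : ℕ) < t.arity → s i = s' i) : t.Contains s = t.Contains s' := by
  cases t <;> simp [Fin.forall_fin_succ, arity] at h <;> simp [Contains, h]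

theorem exists_eq_of_contains (t : Shape) {s : Fin 5 → V} {c a b : V} (h : t.Contains s c a b) :
    ∃ i : Fin 5, (i : ℕ) < t.arity ∧ c = s i := by
  cases t <;>
    simp [Contains, StarShape, FanShape, KiteShape, TetraShape, OnEdge, arity,
      Fin.exists_fin_succ] at * <;> tauto

theorem isIntervalOrderSet_contains [Finite V] {t : Shape} {s : Fin 5 → V} (h : t.Distinct s) :
    IsIntervalOrderSet (t.Contains s) := by
  cases t <;> simp [Distinct, Fin.forall_fin_succ, arity] at h <;> simp only [Contains]
  case empty =>
    exact ⟨fun _ _ => 0, fun _ _ => 0, by simp, by simp, by simp⟩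
  case fan₃ =>
    apply isIntervalOrderSet_fanShape <;> grind
  case fan₄ =>
    apply isIntervalOrderSet_fanShape <;> grind
  case kite =>
    apply isIntervalOrderSet_kiteShape <;> grind
  case tetra =>
    apply isIntervalOrderSet_tetraShape <;> grind
  all_goals apply isIntervalOrderSet_starShape <;> grind

/-! ### Candidates -/

/-- The cherries of `G` in a star belong to a candidate: a vertex that is not the center of a cherry
is left out. -/
theorem exists_isCandidate_starShape {G : SimpleGraph V} {u v z x y : V} (huv : G.Adj u v)
    (huz : G.Adj u z) (hvz : v ≠ z) (hx : x = u ∨ (G.Adj u x ∧ x ≠ v ∧ x ≠ z))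
    (hy : y = u ∨ (G.Adj u y ∧ y ≠ v ∧ y ≠ z)) (hxy : x = y → x = u) :
    ∃ (t : Shape) (s : Fin 5 → V), t.IsCandidate G s ∧
      ∀ c a b, G.Adj c a → G.Adj c b → a ≠ b → StarShape u v z x y c a b → t.Contains s c a b := by
  have hne₁ := huv.ne
  have hne₂ := huz.ne
  -- Of the vertices other than `u`, `v` is a center if it has another neighbor, and `x` is one if it
  -- is adjacent to `v`; similarly for `z` and `y`.
  by_cases hv : ∃ w, G.Adj v w ∧ w ≠ u <;> by_cases hz : ∃ w, G.Adj z w ∧ w ≠ u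
  · obtain ⟨w, hw, hwu⟩ := hv
    obtain ⟨w', hw', hwu'⟩ := hz
    by_cases px : G.Adj x v ∧ x ≠ u <;> by_cases py : G.Adj y z ∧ y ≠ u
    · refine ⟨star₅, ![u, v, z, x, y], ⟨?_, ?_⟩, ?_⟩
      · simp [Distinct, Fin.forall_fin_succ, arity]; grind
      · simp only [Fin.forall_fin_succ, arity, Cherry, Contains]
        simp [-exists_and_left]
        exact ⟨⟨v, z, huv, huz, hvz, by simp [StarShape, OnEdge, IsPair]⟩,
          ⟨u, w, huv.symm, hw, hwu.symm, by simp [StarShape, OnEdge, IsPair]⟩,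
          ⟨u, w', huz.symm, hw', hwu'.symm, by simp [StarShape, OnEdge, IsPair]⟩,
          ⟨u, v, (hx.resolve_left px.2).1.symm, px.1, hne₁, by simp [StarShape, OnEdge, IsPair]⟩,
          ⟨u, z, (hy.resolve_left py.2).1.symm, py.1, hne₂, by simp [StarShape, OnEdge, IsPair]⟩⟩
      · intro c a b hca hcb hab h
        simp only [Contains, StarShape, OnEdge, IsPair] at h ⊢
        simp
        have := hca.symm
        have := hcb.symm
        grind
    · refine ⟨star₄, ![u, v, z, x, u], ⟨?_, ?_⟩, ?_⟩
      · simp [Distinct, Fin.forall_fin_succ, arity]; grind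
      · simp only [Fin.forall_fin_succ, arity, Cherry, Contains]
        simp [-exists_and_left]
        exact ⟨⟨v, z, huv, huz, hvz, by simp [StarShape, OnEdge, IsPair]⟩,
          ⟨u, w, huv.symm, hw, hwu.symm, by simp [StarShape, OnEdge, IsPair]⟩,
          ⟨u, w', huz.symm, hw', hwu'.symm, by simp [StarShape, OnEdge, IsPair]⟩,
          ⟨u, v, (hx.resolve_left px.2).1.symm, px.1, hne₁, by simp [StarShape, OnEdge, IsPair]⟩⟩
      · intro c a b hca hcb hab h
        simp only [Contains, StarShape, OnEdge, IsPair] at h ⊢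
        simp
        have := hca.symm
        have := hcb.symm
        grind
    · refine ⟨star₄, ![u, z, v, y, u], ⟨?_, ?_⟩, ?_⟩
      · simp [Distinct, Fin.forall_fin_succ, arity]; grind
      · simp only [Fin.forall_fin_succ, arity, Cherry, Contains]
        simp [-exists_and_left]
        exact ⟨⟨v, z, huv, huz, hvz, by simp [StarShape, OnEdge, IsPair]⟩,
          ⟨u, w', huz.symm, hw', hwu'.symm, by simp [StarShape, OnEdge, IsPair]⟩,
          ⟨u, w, huv.symm, hw, hwu.symm, by simp [StarShape, OnEdge, IsPair]⟩,
          ⟨u, z, (hy.resolve_left py.2).1.symm, py.1, hne₂, by simp [StarShape, OnEdge, IsPair]⟩⟩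
      · intro c a b hca hcb hab h
        simp only [Contains, StarShape, OnEdge, IsPair] at h ⊢
        simp
        have := hca.symm
        have := hcb.symm
        grind
    · refine ⟨star₃', ![u, v, z, u, u], ⟨?_, ?_⟩, ?_⟩
      · simp [Distinct, Fin.forall_fin_succ, arity]; grind
      · simp only [Fin.forall_fin_succ, arity, Cherry, Contains]
        simp [-exists_and_left]
        exact ⟨⟨v, z, huv, huz, hvz, by simp [StarShape, OnEdge, IsPair]⟩,
          ⟨u, w, huv.symm, hw, hwu.symm, by simp [StarShape, OnEdge, IsPair]⟩,
          ⟨u, w', huz.symm, hw', hwu'.symm, by simp [StarShape, OnEdge, IsPair]⟩⟩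
      · intro c a b hca hcb hab h
        simp only [Contains, StarShape, OnEdge, IsPair] at h ⊢
        simp
        have := hca.symm
        have := hcb.symm
        grind
  · obtain ⟨w, hw, hwu⟩ := hv
    have hz : ∀ w, G.Adj z w → w = u := fun w h => of_not_not fun hn => hz ⟨w, h, hn⟩
    by_cases px : G.Adj x v ∧ x ≠ u
    · refine ⟨star₃, ![u, v, x, u, u], ⟨?_, ?_⟩, ?_⟩
      · simp [Distinct, Fin.forall_fin_succ, arity]; grind
      · simp only [Fin.forall_fin_succ, arity, Cherry, Contains]
        simp [-exists_and_left]
        exact ⟨⟨v, z, huv, huz, hvz, by simp [StarShape, OnEdge, IsPair]⟩,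
          ⟨u, w, huv.symm, hw, hwu.symm, by simp [StarShape, OnEdge, IsPair]⟩,
          ⟨u, v, (hx.resolve_left px.2).1.symm, px.1, hne₁, by simp [StarShape, OnEdge, IsPair]⟩⟩
      · intro c a b hca hcb hab h
        simp only [Contains, StarShape, OnEdge, IsPair] at h ⊢
        simp
        have := hca.symm
        have := hcb.symm
        grind
    · refine ⟨star₂, ![u, v, u, u, u], ⟨?_, ?_⟩, ?_⟩
      · simp [Distinct, Fin.forall_fin_succ, arity]; grind
      · simp only [Fin.forall_fin_succ, arity, Cherry, Contains]
        simp [-exists_and_left]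
        exact ⟨⟨v, z, huv, huz, hvz, by simp [StarShape, OnEdge, IsPair]⟩,
          ⟨u, w, huv.symm, hw, hwu.symm, by simp [StarShape, OnEdge, IsPair]⟩⟩
      · intro c a b hca hcb hab h
        simp only [Contains, StarShape, OnEdge, IsPair] at h ⊢
        simp
        have := hca.symm
        have := hcb.symm
        grind
  · obtain ⟨w', hw', hwu'⟩ := hz
    have hv : ∀ w, G.Adj v w → w = u := fun w h => of_not_not fun hn => hv ⟨w, h, hn⟩
    by_cases py : G.Adj y z ∧ y ≠ u
    · refine ⟨star₃, ![u, z, y, u, u], ⟨?_, ?_⟩, ?_⟩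
      · simp [Distinct, Fin.forall_fin_succ, arity]; grind
      · simp only [Fin.forall_fin_succ, arity, Cherry, Contains]
        simp [-exists_and_left]
        exact ⟨⟨v, z, huv, huz, hvz, by simp [StarShape, OnEdge, IsPair]⟩,
          ⟨u, w', huz.symm, hw', hwu'.symm, by simp [StarShape, OnEdge, IsPair]⟩,
          ⟨u, z, (hy.resolve_left py.2).1.symm, py.1, hne₂, by simp [StarShape, OnEdge, IsPair]⟩⟩
      · intro c a b hca hcb hab h
        simp only [Contains, StarShape, OnEdge, IsPair] at h ⊢
        simp
        have := hca.symm
        have := hcb.symm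
        grind
    · refine ⟨star₂, ![u, z, u, u, u], ⟨?_, ?_⟩, ?_⟩
      · simp [Distinct, Fin.forall_fin_succ, arity]; grind
      · simp only [Fin.forall_fin_succ, arity, Cherry, Contains]
        simp [-exists_and_left]
        exact ⟨⟨v, z, huv, huz, hvz, by simp [StarShape, OnEdge, IsPair]⟩,
          ⟨u, w', huz.symm, hw', hwu'.symm, by simp [StarShape, OnEdge, IsPair]⟩⟩
      · intro c a b hca hcb hab h
        simp only [Contains, StarShape, OnEdge, IsPair] at h ⊢
        simp
        have := hca.symm
        have := hcb.symm
        grind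
  · have hv : ∀ w, G.Adj v w → w = u := fun w h => of_not_not fun hn => hv ⟨w, h, hn⟩
    have hz : ∀ w, G.Adj z w → w = u := fun w h => of_not_not fun hn => hz ⟨w, h, hn⟩
    · refine ⟨star₁, ![u, u, u, u, u], ⟨?_, ?_⟩, ?_⟩
      · simp [Distinct, Fin.forall_fin_succ, arity]
      · simp only [Fin.forall_fin_succ, arity, Cherry, Contains]
        simp [-exists_and_left]
        exact ⟨v, z, huv, huz, hvz, by simp [StarShape, OnEdge, IsPair]⟩
      · intro c a b hca hcb hab h
        simp only [Contains, StarShape, OnEdge, IsPair] at h ⊢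
        simp
        have := hca.symm
        have := hcb.symm
        grind

/-- If `u` is the only neighbor of `z`, then the kite is included in a star. -/
theorem exists_isCandidate_kiteShape {G : SimpleGraph V} {u v z x : V} (huv : G.Adj u v)
    (huz : G.Adj u z) (hvz : v ≠ z) (hux : G.Adj u x) (hvx : G.Adj v x) (hxz : x ≠ z) :
    ∃ (t : Shape) (s : Fin 5 → V), t.IsCandidate G s ∧
      ∀ c a b, G.Adj c a → G.Adj c b → a ≠ b → KiteShape u v z x c a b → t.Contains s c a b := by
  have hne₁ := huv.ne
  have hne₂ := huz.ne
  have hne₃ := hux.ne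
  have hne₄ := hvx.ne
  by_cases hz : ∃ w, G.Adj z w ∧ w ≠ u
  · obtain ⟨w, hw, hwu⟩ := hz
    · refine ⟨kite, ![u, v, z, x, u], ⟨?_, ?_⟩, ?_⟩
      · simp [Distinct, Fin.forall_fin_succ, arity]; grind
      · simp only [Fin.forall_fin_succ, arity, Cherry, Contains]
        simp [-exists_and_left]
        exact ⟨⟨v, z, huv, huz, hvz, by simp [KiteShape, OnEdge, IsPair]⟩,
          ⟨u, x, huv.symm, hvx, hne₃, by simp [KiteShape, OnEdge, IsPair]⟩,
          ⟨u, w, huz.symm, hw, hwu.symm, by simp [KiteShape, OnEdge, IsPair]⟩,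
          ⟨u, v, hux.symm, hvx.symm, hne₁, by simp [KiteShape, OnEdge, IsPair]⟩⟩
      · intro c a b hca hcb hab h
        simp only [Contains, KiteShape, OnEdge, IsPair] at h ⊢
        simp
        have := hca.symm
        have := hcb.symm
        grind
  · have hz : ∀ w, G.Adj z w → w = u := fun w h => of_not_not fun hn => hz ⟨w, h, hn⟩
    · refine ⟨star₃, ![u, v, x, u, u], ⟨?_, ?_⟩, ?_⟩
      · simp [Distinct, Fin.forall_fin_succ, arity]; grind
      · simp only [Fin.forall_fin_succ, arity, Cherry, Contains]
        simp [-exists_and_left]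
        exact ⟨⟨v, z, huv, huz, hvz, by simp [StarShape, OnEdge, IsPair]⟩,
          ⟨u, x, huv.symm, hvx, hne₃, by simp [StarShape, OnEdge, IsPair]⟩,
          ⟨u, v, hux.symm, hvx.symm, hne₁, by simp [StarShape, OnEdge, IsPair]⟩⟩
      · intro c a b hca hcb hab h
        simp only [Contains, StarShape, KiteShape, OnEdge, IsPair] at h ⊢
        simp
        have := hca.symm
        have := hcb.symm
        grind

theorem exists_isCandidate_tetraShape {G : SimpleGraph V} {u v z x : V} (huv : G.Adj u v)
    (huz : G.Adj u z) (hvz : v ≠ z) (hzx : G.Adj z x) (hvx : G.Adj v x) (hxu : x ≠ u) :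
    ∃ (t : Shape) (s : Fin 5 → V), t.IsCandidate G s ∧
      ∀ c a b, G.Adj c a → G.Adj c b → a ≠ b → TetraShape u v z x c a b → t.Contains s c a b := by
  have hne₁ := huv.ne
  have hne₂ := huz.ne
  have hne₃ := hzx.ne
  have hne₄ := hvx.ne
  refine ⟨tetra, ![u, v, z, x, u], ⟨?_, ?_⟩, ?_⟩
  · simp [Distinct, Fin.forall_fin_succ, arity]; grind
  · simp only [Fin.forall_fin_succ, arity, Cherry, Contains]
    simp [-exists_and_left]
    exact ⟨⟨v, z, huv, huz, hvz, by simp [TetraShape, OnEdge]⟩,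
      ⟨u, x, huv.symm, hvx, hxu.symm, by simp [TetraShape, OnEdge]⟩,
      ⟨u, x, huz.symm, hzx, hxu.symm, by simp [TetraShape, OnEdge]⟩,
      ⟨v, z, hvx.symm, hzx.symm, hvz, by simp [TetraShape, OnEdge]⟩⟩
  · exact fun c a b _ _ _ h => h

/-- The vertex `x` is left out if it is not the center of a cherry. -/
theorem exists_isCandidate_fanShape {G : SimpleGraph V} {u v z x : V} (huv : G.Adj u v)
    (huz : G.Adj u z) (hvz : G.Adj v z) (hvx : G.Adj v x) (hxu : x ≠ u) (hxz : x ≠ z) :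
    ∃ (t : Shape) (s : Fin 5 → V), t.IsCandidate G s ∧
      ∀ c a b, G.Adj c a → G.Adj c b → a ≠ b → FanShape u v z x c a b → t.Contains s c a b := by
  have hne₁ := huv.ne
  have hne₂ := huz.ne
  have hne₃ := hvz.ne
  have hne₄ := hvx.ne
  by_cases hx : G.Adj x u ∨ G.Adj x z
  · refine ⟨fan₄, ![u, v, z, x, u], ⟨?_, ?_⟩, ?_⟩
    · simp [Distinct, Fin.forall_fin_succ, arity]; grind
    · simp only [Fin.forall_fin_succ, arity, Cherry, Contains]
      simp [-exists_and_left]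
      exact ⟨⟨v, z, huv, huz, hne₃, by simp [FanShape, OnEdge, IsPair]⟩,
        ⟨u, z, huv.symm, hvz, hne₂, by simp [FanShape, OnEdge, IsPair]⟩,
        ⟨u, v, huz.symm, hvz.symm, hne₁, by simp [FanShape, OnEdge, IsPair]⟩,
        hx.elim (fun hx => ⟨u, v, hx, hvx.symm, hne₁, by simp [FanShape, OnEdge, IsPair]⟩)
        (fun hx => ⟨v, z, hvx.symm, hx, hne₃, by simp [FanShape, OnEdge, IsPair]⟩)⟩
    · intro c a b hca hcb hab h
      simp only [Contains, FanShape, OnEdge, IsPair] at h ⊢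
      simp
      have := hca.symm
      have := hcb.symm
      grind
  · refine ⟨fan₃, ![u, v, z, u, u], ⟨?_, ?_⟩, ?_⟩
    · simp [Distinct, Fin.forall_fin_succ, arity]; grind
    · simp only [Fin.forall_fin_succ, arity, Cherry, Contains]
      simp [-exists_and_left]
      exact ⟨⟨v, z, huv, huz, hne₃, by simp [FanShape, OnEdge, IsPair]⟩,
        ⟨u, z, huv.symm, hvz, hne₂, by simp [FanShape, OnEdge, IsPair]⟩,
        ⟨u, v, huz.symm, hvz.symm, hne₁, by simp [FanShape, OnEdge, IsPair]⟩⟩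
    · intro c a b hca hcb hab h
      simp only [Contains, FanShape, OnEdge, IsPair] at h ⊢
      simp
      have := hca.symm
      have := hcb.symm
      grind

/-- Every interval order of the edges in which only edges with a common end are comparable is
contained in a candidate. -/
theorem exists_isCandidate [Finite V] [Nonempty V] {G : SimpleGraph V} {l r : V → V → ℝ}
    (h : IsEdgeOrder G l r) :
    ∃ (t : Shape) (s : Fin 5 → V), t.IsCandidate G s ∧ Covers G l r (t.Contains s) := by
  have ne_of_lt : ∀ {c a b}, G.Adj c a → G.Adj c b → r c a < l c b → a ≠ b := by
    intro c a b hca hcb hlt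
    have := h.share _ _ _ _ hca hcb hlt
    have := hca.ne
    have := hcb.ne
    unfold ShareEnd at *
    grind
  have lift : ∀ {Q : V → V → V → Prop}, Covers G l r Q → (∃ (t : Shape) (s : Fin 5 → V),
      t.IsCandidate G s ∧ ∀ c a b, G.Adj c a → G.Adj c b → a ≠ b → Q c a b → t.Contains s c a b) →
      ∃ (t : Shape) (s : Fin 5 → V), t.IsCandidate G s ∧ Covers G l r (t.Contains s) :=
    fun hQ ⟨t, s, hs, hc⟩ => ⟨t, s, hs, fun c a b hca hcb hlt =>
      hc c a b hca hcb (ne_of_lt hca hcb hlt) (hQ c a b hca hcb hlt)⟩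
  by_cases hne : ∃ c a b, G.Adj c a ∧ G.Adj c b ∧ r c a < l c b
  · obtain ⟨u, v, z, hvz, huv, huz, hc⟩ := h.exists_covers hne
    rcases hc with hc | ⟨x, y, hx, hy, hxy, hxv, hxz, hyv, hyz, hc⟩ | ⟨x, hux, hvx, hxz, hc⟩ |
      ⟨x, hux, hzx, hxv, hc⟩ | ⟨x, hzx, hvx, hxu, hc⟩ | ⟨x, hvz', hvx, hxu, hxz, hc⟩ |
      ⟨x, hvz', hzx, hxu, hxv, hc⟩
    · refine lift (Q := StarShape u v z u u) (fun c a b hca hcb hlt => ?_)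
        (exists_isCandidate_starShape huv huz hvz (.inl rfl) (.inl rfl) fun _ => rfl)
      exact (hc c a b hca hcb hlt).elim (fun h => .inr (.inl h)) fun h => .inr (.inr (.inl h))
    · exact lift hc (exists_isCandidate_starShape huv huz hvz (.inr ⟨hx, hxv, hxz⟩)
        (.inr ⟨hy, hyv, hyz⟩) fun h => (hxy h).elim)
    · exact lift hc (exists_isCandidate_kiteShape huv huz hvz hux hvx hxz)
    · exact lift hc (exists_isCandidate_kiteShape huz huv hvz.symm hux hzx hxv)
    · exact lift hc (exists_isCandidate_tetraShape huv huz hvz hzx hvx hxu)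
    · exact lift hc (exists_isCandidate_fanShape huv huz hvz' hvx hxu hxz)
    · exact lift hc (exists_isCandidate_fanShape huz huv hvz'.symm hzx hxu hxv)
  · obtain ⟨u⟩ := ‹Nonempty V›
    exact ⟨empty, fun _ => u, ⟨by simp [Distinct, arity], by simp [arity]⟩,
      fun c a b hca hcb hlt => hne ⟨c, a, b, hca, hcb, hlt⟩⟩

end Shape

/-! ### Interval-completions of the complement of the line graph -/

/-- The graph on the edges of `G` in which the two edges of every cherry in `Q` are adjacent. -/
def cherryGraph {V : Type*} (G : SimpleGraph V) (Q : V → V → V → Prop) :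
    SimpleGraph G.edgeSet where
  Adj e f := ∃ c a b, a ≠ b ∧ (e : Sym2 V) = s(c, a) ∧ (f : Sym2 V) = s(c, b) ∧
    (Q c a b ∨ Q c b a)
  symm := ⟨fun _ _ ⟨c, a, b, h, he, hf, hQ⟩ => ⟨c, b, a, h.symm, hf, he, hQ.symm⟩⟩
  loopless := ⟨fun _ ⟨_, _, _, h, he, hf, _⟩ => h (Sym2.congr_right.1 (he.symm.trans hf))⟩

theorem cherryGraph_adj_mk {V : Type*} {G : SimpleGraph V} {Q : V → V → V → Prop} {c a b : V}
    (ha : G.Adj c a) (hb : G.Adj c b) (hab : a ≠ b) :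
    (cherryGraph G Q).Adj ⟨s(c, a), ha⟩ ⟨s(c, b), hb⟩ ↔ Q c a b ∨ Q c b a := by
  refine ⟨fun ⟨c', a', b', h, he, hf, hQ⟩ => ?_, fun h => ⟨c, a, b, hab, rfl, rfl, h⟩⟩
  simp only [Sym2.eq_iff] at he hf
  have := ha.ne
  have := hb.ne
  grind

theorem cherryGraph_le_iff {V : Type*} {G : SimpleGraph V} {Q : V → V → V → Prop}
    {F : SimpleGraph G.edgeSet} :
    cherryGraph G Q ≤ F ↔ ∀ (c a b : V) (ha : G.Adj c a) (hb : G.Adj c b), a ≠ b → Q c a b →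
      F.Adj ⟨s(c, a), ha⟩ ⟨s(c, b), hb⟩ := by
  refine ⟨fun h c a b ha hb hab hQ => h ((cherryGraph_adj_mk ha hb hab).2 (.inl hQ)), ?_⟩
  rintro h ⟨e, he⟩ ⟨f, hf⟩ ⟨c, a, b, hab, rfl, rfl, hQ⟩
  exact hQ.elim (h c a b he hf hab) fun hQ => (h c b a hf he hab.symm hQ).symm

theorem cherryGraph_le_lineGraph {V : Type*} (G : SimpleGraph V) (Q : V → V → V → Prop) :
    cherryGraph G Q ≤ G.lineGraph := by
  rw [cherryGraph_le_iff]
  intro c a b ha hb hab _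
  refine ⟨fun h => hab (Sym2.congr_right.1 (Subtype.ext_iff.1 h)), c, by simp⟩

/-- Two edges with a common end form a cherry. -/
theorem exists_eq_mk_of_lineGraph_adj {V : Type*} {G : SimpleGraph V} {e f : G.edgeSet}
    (h : G.lineGraph.Adj e f) : ∃ (c a b : V) (ha : G.Adj c a) (hb : G.Adj c b), a ≠ b ∧
      e = ⟨s(c, a), ha⟩ ∧ f = ⟨s(c, b), hb⟩ := by
  obtain ⟨hne, c, hc, hc'⟩ := h
  obtain ⟨e, he⟩ := e
  obtain ⟨f, hf⟩ := f
  obtain ⟨a, rfl⟩ := Sym2.mem_iff_exists.1 hc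
  obtain ⟨b, rfl⟩ := Sym2.mem_iff_exists.1 hc'
  exact ⟨c, a, b, he, hf, fun h => hne (by simp [h]), rfl, rfl⟩

/-- An interval order whose comparable pairs are cherries gives an interval-completion. -/
theorem IsIntervalOrderSet.isIntervalCompletion {V : Type*} {Q : V → V → V → Prop}
    (h : IsIntervalOrderSet Q) (G : SimpleGraph V) :
    IsIntervalCompletion G.lineGraphᶜ (cherryGraph G Q)ᶜ := by
  refine ⟨compl_le_compl (cherryGraph_le_lineGraph G Q), ?_⟩
  obtain ⟨l, r, hsymm, hQ, hshare⟩ := h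
  let L : Sym2 V → ℤ := Sym2.lift ⟨l, fun p q => (hsymm p q).1⟩
  let R : Sym2 V → ℤ := Sym2.lift ⟨r, fun p q => (hsymm p q).2.1⟩
  refine ⟨fun e => L e, fun e => R e, ?_, ?_⟩
  · rintro ⟨e, he⟩
    induction e with | _ p q
    exact Int.cast_le.2 ((hsymm p q).2.2 (SimpleGraph.Adj.ne he))
  · intro e f
    rw [SimpleGraph.compl_adj, Set.Icc_inter_Icc, Set.nonempty_Icc]
    refine and_congr_right fun hne => ?_
    have hL : ∀ p q, L s(p, q) = l p q := fun _ _ => rfl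
    have hR : ∀ p q, R s(p, q) = r p q := fun _ _ => rfl
    have he : L e ≤ R e := by
      obtain ⟨e, he⟩ := e
      induction e with | _ p q
      exact (hsymm p q).2.2 (SimpleGraph.Adj.ne he)
    have hf : L f ≤ R f := by
      obtain ⟨f, hf⟩ := f
      induction f with | _ p q
      exact (hsymm p q).2.2 (SimpleGraph.Adj.ne hf)
    have key : (cherryGraph G Q).Adj e f ↔ R e < L f ∨ R f < L e := by
      constructor
      · intro h
        obtain ⟨c, a, b, ha, hb, hab, rfl, rfl⟩ :=
          exists_eq_mk_of_lineGraph_adj (cherryGraph_le_lineGraph G Q h)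
        have := (cherryGraph_adj_mk ha hb hab).1 h
        rw [hQ _ _ _ hab ha.ne hb.ne, hQ _ _ _ hab.symm hb.ne ha.ne] at this
        simp only [hL, hR]
        tauto
      · intro h
        have hadj : G.lineGraph.Adj e f := by
          refine ⟨hne, ?_⟩
          obtain ⟨e, he'⟩ := e
          obtain ⟨f, hf'⟩ := f
          induction e with | _ p q
          induction f with | _ p' q'
          have h1 := hshare p q p' q' (SimpleGraph.Adj.ne he') (SimpleGraph.Adj.ne hf')
          have h2 := hshare p' q' p q (SimpleGraph.Adj.ne hf') (SimpleGraph.Adj.ne he')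
          simp only [hL, hR] at h
          rcases (by tauto : p = p' ∨ p = q' ∨ q = p' ∨ q = q') with rfl | rfl | rfl | rfl
          · exact ⟨p, by simp⟩
          · exact ⟨p, by simp⟩
          · exact ⟨q, by simp⟩
          · exact ⟨q, by simp⟩
        obtain ⟨c, a, b, ha, hb, hab, rfl, rfl⟩ := exists_eq_mk_of_lineGraph_adj hadj
        rw [cherryGraph_adj_mk ha hb hab]
        exact .inl ((hQ _ _ _ hab ha.ne hb.ne).2 h)
    rw [key, max_le_iff, le_min_iff, le_min_iff]
    simp only [Int.cast_le]
    grind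

/-- An interval-completion gives an interval order of the edges; it contains the complement of every
set of cherries to which all comparable pairs belong. -/
theorem IsIntervalCompletion.exists_isEdgeOrder {V : Type*} {G : SimpleGraph V}
    {H : SimpleGraph G.edgeSet} (h : IsIntervalCompletion G.lineGraphᶜ H) :
    ∃ l r : V → V → ℝ, IsEdgeOrder G l r ∧
      ∀ Q, Covers G l r Q → (cherryGraph G Q)ᶜ ≤ H := by
  classical
  obtain ⟨hle, l, r, hlr, hadj⟩ := h
  -- The values for pairs that are not edges of `G` do not matter.
  let L : Sym2 V → ℝ := fun e => if he : e ∈ G.edgeSet then l ⟨e, he⟩ else 0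
  let R : Sym2 V → ℝ := fun e => if he : e ∈ G.edgeSet then r ⟨e, he⟩ else 0
  have hL : ∀ e : G.edgeSet, L e = l e := fun e => by simp [L]
  have hR : ∀ e : G.edgeSet, R e = r e := fun e => by simp [R]
  have key : ∀ e f : G.edgeSet, r e < l f → ¬ H.Adj e f ∧ e ≠ f := by
    intro e f hlt
    refine ⟨fun h => ?_, ?_⟩
    · obtain ⟨x, hx, hx'⟩ := ((hadj e f).1 h).2
      exact absurd (hx.2.trans_lt (hlt.trans_le hx'.1)) (lt_irrefl x)
    · rintro rfl
      exact absurd (hlt.trans_le (hlr e)) (lt_irrefl _)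
  refine ⟨fun p q => L s(p, q), fun p q => R s(p, q),
    ⟨fun p q => by rw [Sym2.eq_swap], fun p q => by rw [Sym2.eq_swap], ?_⟩, ?_⟩
  · intro p q p' q' hpq hpq' hlt
    have h1 := key ⟨s(p, q), hpq⟩ ⟨s(p', q'), hpq'⟩ (by rw [← hL, ← hR]; exact hlt)
    have h2 : G.lineGraph.Adj ⟨s(p, q), hpq⟩ ⟨s(p', q'), hpq'⟩ := by
      by_contra h
      exact h1.1 (hle ((SimpleGraph.compl_adj _ _ _).2 ⟨h1.2, h⟩))
    obtain ⟨c, a, b, ha, hb, hab, he, hf⟩ := exists_eq_mk_of_lineGraph_adj h2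
    have he := Sym2.eq_iff.1 (congrArg Subtype.val he)
    have hf := Sym2.eq_iff.1 (congrArg Subtype.val hf)
    have := ha.ne
    have := hb.ne
    unfold ShareEnd
    grind
  · intro Q hQ
    rw [compl_le_iff_compl_le]
    intro e f hef
    have hne : e ≠ f := hef.ne
    have hH : ¬ H.Adj e f := ((SimpleGraph.compl_adj _ _ _).1 hef).2
    have h2 : G.lineGraph.Adj e f := by
      by_contra h
      exact hH (hle ((SimpleGraph.compl_adj _ _ _).2 ⟨hne, h⟩))
    obtain ⟨c, a, b, ha, hb, hab, rfl, rfl⟩ := exists_eq_mk_of_lineGraph_adj h2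
    rw [cherryGraph_adj_mk ha hb hab]
    have h3 := fun h => hH ((hadj _ _).2 ⟨hne, h⟩)
    rw [Set.Icc_inter_Icc, Set.nonempty_Icc, max_le_iff, le_min_iff, le_min_iff] at h3
    have h4 := hlr ⟨s(c, a), ha⟩
    have h5 := hlr ⟨s(c, b), hb⟩
    have h6 := hQ c a b ha hb
    have h7 := hQ c b a hb ha
    beta_reduce at h6 h7
    rw [show R s(c, a) = _ from hR ⟨s(c, a), ha⟩, show L s(c, b) = _ from hL ⟨s(c, b), hb⟩] at h6
    rw [show R s(c, b) = _ from hR ⟨s(c, b), hb⟩, show L s(c, a) = _ from hL ⟨s(c, a), ha⟩] at h7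
    grind

namespace Shape

variable {V : Type*}

/-- The completion that corresponds to a shape. -/
def completion (G : SimpleGraph V) (t : Shape) (s : Fin 5 → V) : SimpleGraph G.edgeSet :=
  (cherryGraph G (t.Contains s))ᶜ

/-- All cherries of `G` in the first shape belong to the second. Only cherries whose center is a
parameter of the first shape have to be tested. -/
def Included (G : SimpleGraph V) (t : Shape) (s : Fin 5 → V) (t' : Shape) (s' : Fin 5 → V) : Prop :=
  ∀ i : Fin 5, (i : ℕ) < t.arity → ∀ a b, t.Cherry G s (s i) a b → t'.Contains s' (s i) a b

theorem Included.contains {G : SimpleGraph V} {t t' : Shape} {s s' : Fin 5 → V}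
    (h : Included G t s t' s') {c a b : V} (hc : t.Cherry G s c a b) : t'.Contains s' c a b := by
  obtain ⟨i, hi, rfl⟩ := t.exists_eq_of_contains hc.2.2.2
  exact h i hi a b hc

/-- Larger sets of cherries correspond to smaller completions. -/
theorem completion_le_completion_iff {G : SimpleGraph V} {t t' : Shape} {s s' : Fin 5 → V} :
    t'.completion G s' ≤ t.completion G s ↔ Included G t s t' s' := by
  rw [completion, completion, compl_le_compl_iff_le, cherryGraph_le_iff]
  constructor
  · rintro h i - a b ⟨ha, hb, hab, hc⟩
    exact ((cherryGraph_adj_mk ha hb hab).1 (h _ a b ha hb hab hc)).elim id t'.contains_swap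
  · exact fun h c a b ha hb hab hc =>
      (cherryGraph_adj_mk ha hb hab).2 (.inl (h.contains ⟨ha, hb, hab, hc⟩))

theorem isIntervalCompletion_completion [Finite V] (G : SimpleGraph V) {t : Shape} {s : Fin 5 → V}
    (h : t.Distinct s) : IsIntervalCompletion G.lineGraphᶜ (t.completion G s) :=
  (isIntervalOrderSet_contains h).isIntervalCompletion G

theorem exists_completion_le [Finite V] [Nonempty V] {G : SimpleGraph V} {H : SimpleGraph G.edgeSet}
    (h : IsIntervalCompletion G.lineGraphᶜ H) :
    ∃ (t : Shape) (s : Fin 5 → V), t.IsCandidate G s ∧ t.completion G s ≤ H := by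
  obtain ⟨l, r, hlr, hle⟩ := h.exists_isEdgeOrder
  obtain ⟨t, s, hs, hc⟩ := exists_isCandidate hlr
  exact ⟨t, s, hs, hle _ hc⟩

/-- The minimal completions are the minimal elements among those that come from candidates. -/
theorem isMinimalIntervalCompletion_iff [Finite V] [Nonempty V] {G : SimpleGraph V}
    {H : SimpleGraph G.edgeSet} : IsMinimalIntervalCompletion G.lineGraphᶜ H ↔
      ∃ (t : Shape) (s : Fin 5 → V), t.IsCandidate G s ∧ t.completion G s = H ∧
        ∀ (t' : Shape) (s' : Fin 5 → V), t'.IsCandidate G s' → Included G t s t' s' →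
          Included G t' s' t s := by
  constructor
  · intro h
    obtain ⟨t, s, hs, hle⟩ := exists_completion_le h.prop
    have heq : t.completion G s = H :=
      hle.antisymm (h.le_of_le (isIntervalCompletion_completion G hs.1) hle)
    refine ⟨t, s, hs, heq, fun t' s' hs' hi => ?_⟩
    rw [← completion_le_completion_iff] at hi ⊢
    rw [heq] at hi ⊢
    exact h.le_of_le (isIntervalCompletion_completion G hs'.1) hi
  · rintro ⟨t, s, hs, rfl, hmin⟩
    refine ⟨isIntervalCompletion_completion G hs.1, fun H hH hle => ?_⟩
    obtain ⟨t', s', hs', hle'⟩ := exists_completion_le hH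
    have := hmin t' s' hs' (completion_le_completion_iff.1 (hle'.trans hle))
    exact (completion_le_completion_iff.2 this).trans hle'

/-! ### The number of minimal completions -/

/-- A surjection of the five positions onto the parameters. Different kinds of shapes have
different partitions of the positions. -/
def pattern : Shape → Fin 5 → Fin 5
  | empty => ![0, 0, 0, 0, 0]
  | star₁ => ![0, 0, 0, 0, 0]
  | star₂ => ![0, 1, 1, 1, 1]
  | star₃ => ![0, 1, 2, 2, 2]
  | star₃' => ![0, 0, 1, 2, 2]
  | star₄ => ![0, 1, 2, 3, 3]
  | star₅ => ![0, 1, 2, 3, 4]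
  | fan₃ => ![0, 0, 0, 1, 2]
  | fan₄ => ![0, 1, 2, 2, 3]
  | kite => ![0, 1, 1, 2, 3]
  | tetra => ![0, 0, 1, 2, 3]

theorem pattern_lt_arity {t : Shape} (h : t ≠ empty) (k : Fin 5) : (t.pattern k : ℕ) < t.arity := by
  revert k
  cases t <;> first | exact (h rfl).elim | simp [Fin.forall_fin_succ, pattern, arity]

theorem exists_pattern_eq (t : Shape) {i : Fin 5} (hi : (i : ℕ) < t.arity) :
    ∃ k, t.pattern k = i := by
  revert i
  cases t <;> simp [Fin.forall_fin_succ, Fin.exists_fin_succ, pattern, arity]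

theorem eq_of_pattern {t t' : Shape} (h : t ≠ empty) (h' : t' ≠ empty)
    (hp : ∀ i k, t.pattern i = t.pattern k ↔ t'.pattern i = t'.pattern k) : t = t' := by
  cases t <;> cases t' <;>
    first | rfl | exact (h rfl).elim | exact (h' rfl).elim | (exfalso; revert hp; decide)

theorem Distinct.apply_eq_iff {t : Shape} {s : Fin 5 → V} (h : t.Distinct s) {i j : Fin 5}
    (hi : (i : ℕ) < t.arity) (hj : (j : ℕ) < t.arity) : s i = s j ↔ i = j := by
  refine ⟨fun he => ?_, congrArg s⟩
  rcases lt_trichotomy i j with hlt | rfl | hlt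
  · exact (h i j hlt hj he).elim
  · rfl
  · exact (h j i hlt hi he.symm).elim

/-- A shape and its parameters can be recovered from five vertices, which are the parameters
repeated according to the pattern. -/
theorem eq_of_comp_pattern {t t' : Shape} (ht : t ≠ empty) (ht' : t' ≠ empty) {s s' : Fin 5 → V}
    (hs : t.Distinct s) (hs' : t'.Distinct s') (h : s ∘ t.pattern = s' ∘ t'.pattern) :
    t = t' ∧ ∀ i : Fin 5, (i : ℕ) < t.arity → s i = s' i := by
  have heq : t = t' := by
    refine eq_of_pattern ht ht' fun i k => ?_
    rw [← hs.apply_eq_iff (pattern_lt_arity ht i) (pattern_lt_arity ht k),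
      ← hs'.apply_eq_iff (pattern_lt_arity ht' i) (pattern_lt_arity ht' k)]
    exact Eq.congr (congrFun h i) (congrFun h k)
  subst heq
  refine ⟨rfl, fun i hi => ?_⟩
  obtain ⟨k, rfl⟩ := t.exists_pattern_eq hi
  exact congrFun h k

/-- For counting, the empty shape is not needed. -/
theorem exists_eq_completion [Finite V] [Nonempty V] {G : SimpleGraph V} {H : SimpleGraph G.edgeSet}
    (h : IsMinimalIntervalCompletion G.lineGraphᶜ H) :
    ∃ (t : Shape) (s : Fin 5 → V), t ≠ empty ∧ t.Distinct s ∧ t.completion G s = H := by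
  obtain ⟨t, s, hs, heq, -⟩ := isMinimalIntervalCompletion_iff.1 h
  by_cases ht : t = empty
  · -- A star with a single parameter contains the empty shape.
    subst ht
    obtain ⟨u⟩ := ‹Nonempty V›
    have hd : star₁.Distinct fun _ => u := by simp [Distinct, arity, Fin.forall_fin_succ]
    have hle : star₁.completion G (fun _ => u) ≤ H := by
      rw [← heq, completion_le_completion_iff]
      simp [Included, arity]
    exact ⟨star₁, _, by simp, hd,
      hle.antisymm (h.le_of_le (isIntervalCompletion_completion G hd) hle)⟩
  · exact ⟨t, s, ht, hs.1, heq⟩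

/-- The minimal completions inject into the 5-tuples of vertices. -/
theorem encard_isMinimalIntervalCompletion_le [Fintype V] [Nonempty V] (G : SimpleGraph V) :
    {H : SimpleGraph G.edgeSet | IsMinimalIntervalCompletion G.lineGraphᶜ H}.encard
      ≤ (Fintype.card V : ℕ∞) ^ 5 := by
  classical
  choose! t s ht hs heq using fun (H : SimpleGraph G.edgeSet)
    (h : IsMinimalIntervalCompletion G.lineGraphᶜ H) => exists_eq_completion h
  have hinj : Set.InjOn (fun H => s H ∘ (t H).pattern)
      {H : SimpleGraph G.edgeSet | IsMinimalIntervalCompletion G.lineGraphᶜ H} := by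
    intro H hH H' hH' h
    have h' := eq_of_comp_pattern (ht H hH) (ht H' hH') (hs H hH) (hs H' hH') h
    rw [← heq H hH, ← heq H' hH', completion, completion, contains_congr _ h'.2, h'.1]
  rw [← hinj.encard_image]
  refine (Set.encard_le_encard (Set.subset_univ _)).trans ?_
  simp [Set.encard_univ]

end Shape

/-! ### Selecting one candidate for every minimal completion -/

namespace Shape

variable {V : Type*}

/-- The position of a kind of shapes in the list `Shape.all`. -/
def index : Shape → ℕ
  | empty => 0
  | star₁ => 1
  | star₂ => 2
  | star₃ => 3
  | star₃' => 4
  | star₄ => 5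
  | star₅ => 6
  | fan₃ => 7
  | fan₄ => 8
  | kite => 9
  | tetra => 10

/-- The list of all kinds of shapes. -/
def all : List Shape :=
  [empty, star₁, star₂, star₃, star₃', star₄, star₅, fan₃, fan₄, kite, tetra]

theorem mem_all (t : Shape) : t ∈ all := by
  cases t <;> simp [all]

theorem nodup_all : all.Nodup := by
  simp [all]

theorem index_injective : Function.Injective index := by
  intro t t' h
  cases t <;> cases t' <;> first | rfl | simp [index] at h

/-- The order by which ties between candidates are broken: first the kinds of the shapes are
compared, then the parameters lexicographically. -/
def Before [LT V] (t : Shape) (s : Fin 5 → V) (t' : Shape) (s' : Fin 5 → V) : Prop :=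
  t.index < t'.index ∨ (t.index = t'.index ∧
    ∃ i : Fin 5, (i : ℕ) < t.arity ∧ (∀ j < i, s j = s' j) ∧ s i < s' i)

/-- The candidates that the algorithm outputs: those with inclusion-wise maximal sets of cherries,
provided that no other candidate with the same set comes before. -/
def IsSelected [LT V] (G : SimpleGraph V) (t : Shape) (s : Fin 5 → V) : Prop :=
  t.IsCandidate G s ∧ ∀ (t' : Shape) (s' : Fin 5 → V), t'.IsCandidate G s' →
    Included G t s t' s' → Included G t' s' t s ∧ ¬ Before t' s' t s

theorem eq_of_not_before [LinearOrder V] {t t' : Shape} {s s' : Fin 5 → V}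
    (h : ¬ Before t s t' s') (h' : ¬ Before t' s' t s) :
    t = t' ∧ ∀ i : Fin 5, (i : ℕ) < t.arity → s i = s' i := by
  have heq : t = t' := by
    apply index_injective
    unfold Before at *
    omega
  subst heq
  refine ⟨rfl, fun i => ?_⟩
  simp only [Before, lt_irrefl, true_and, false_or, not_exists, not_and, not_lt] at h h'
  induction i using WellFoundedLT.induction with
  | ind i ih =>
    intro hi
    have hj : ∀ j < i, s j = s' j := fun j hj => ih j hj (hi.trans' hj)
    exact le_antisymm (h' i hi fun j h => (hj j h).symm) (h i hi hj)

/-- Different selected candidates represent different completions. -/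
theorem IsSelected.eq_of_completion_eq [LinearOrder V] {G : SimpleGraph V} {t t' : Shape}
    {s s' : Fin 5 → V} (h : t.IsSelected G s) (h' : t'.IsSelected G s')
    (heq : t.completion G s = t'.completion G s') :
    t = t' ∧ ∀ i : Fin 5, (i : ℕ) < t.arity → s i = s' i :=
  eq_of_not_before (h'.2 t s h.1 (completion_le_completion_iff.1 heq.le)).2
    (h.2 t' s' h'.1 (completion_le_completion_iff.1 heq.ge)).2

/-- The selected candidates represent all minimal completions. -/
theorem isMinimalIntervalCompletion_iff_exists_isSelected [LinearOrder V] [Finite V] [Nonempty V]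
    {G : SimpleGraph V} {H : SimpleGraph G.edgeSet} :
    IsMinimalIntervalCompletion G.lineGraphᶜ H ↔
      ∃ (t : Shape) (s : Fin 5 → V), t.IsSelected G s ∧ t.completion G s = H := by
  constructor
  · intro h
    obtain ⟨t₀, s₀, h₀, heq₀, hmax⟩ := isMinimalIntervalCompletion_iff.1 h
    let P : Shape → (Fin 5 → V) → Prop := fun t s => t.IsCandidate G s ∧ t.completion G s = H
    -- Among the candidates that represent `H`, the first one is selected.
    obtain ⟨t, ⟨s₁, hs₁⟩, ht⟩ : ∃ t, (∃ s, P t s) ∧ ∀ t' s', P t' s' → t.index ≤ t'.index := by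
      obtain ⟨t, ht, hmin⟩ := (InvImage.wf index Nat.lt_wfRel.wf).has_min
        {t | ∃ s, P t s} ⟨t₀, s₀, h₀, heq₀⟩
      exact ⟨t, ht, fun t' s' h' => not_lt.1 (hmin t' ⟨s', h'⟩)⟩
    obtain ⟨s, hs, hmin⟩ := (Set.toFinite {s | P t s}).exists_minimalFor
      (fun s => toLex s) _ ⟨s₁, hs₁⟩
    refine ⟨t, s, ⟨hs.1, fun t' s' hs' hi => ?_⟩, hs.2⟩
    have hi' : Included G t' s' t s := by
      have h1 : t'.completion G s' ≤ t₀.completion G s₀ := by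
        rw [heq₀, ← hs.2]
        exact completion_le_completion_iff.2 hi
      have h2 := completion_le_completion_iff.2
        (hmax t' s' hs' (completion_le_completion_iff.1 h1))
      rw [heq₀, ← hs.2] at h2
      exact completion_le_completion_iff.1 h2
    have hP : P t' s' := ⟨hs', hs.2 ▸ (completion_le_completion_iff.2 hi).antisymm
      (completion_le_completion_iff.2 hi')⟩
    refine ⟨hi', fun hb => ?_⟩
    rcases hb with hb | ⟨hb, i, -, hj, hlt⟩
    · exact absurd hb (not_lt.2 (ht t' s' hP))
    · obtain rfl := index_injective hb
      have hlex : toLex s' < toLex s := ⟨i, hj, hlt⟩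
      exact absurd hlex (not_lt.2 (hmin (j := s') hP hlex.le))
  · rintro ⟨t, s, hs, heq⟩
    exact isMinimalIntervalCompletion_iff.2 ⟨t, s, hs.1, heq, fun t' s' h h' => (hs.2 t' s' h h').1⟩

theorem cherry_congr (G : SimpleGraph V) (t : Shape) {s s' : Fin 5 → V}
    (h : ∀ i : Fin 5, (i : ℕ) < t.arity → s i = s' i) : t.Cherry G s = t.Cherry G s' := by
  unfold Cherry
  rw [t.contains_congr h]

theorem isCandidate_congr (G : SimpleGraph V) (t : Shape) {s s' : Fin 5 → V}
    (h : ∀ i : Fin 5, (i : ℕ) < t.arity → s i = s' i) : t.IsCandidate G s ↔ t.IsCandidate G s' := by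
  refine and_congr (forall_congr' fun i => forall_congr' fun j => ?_) (forall_congr' fun i => ?_)
  · exact forall_congr' fun hij => forall_congr' fun hj => by rw [h i (hj.trans' hij), h j hj]
  · exact forall_congr' fun hi => by rw [t.cherry_congr G h, h i hi]

theorem included_congr_left (G : SimpleGraph V) {t t' : Shape} {s s' s'' : Fin 5 → V}
    (h : ∀ i : Fin 5, (i : ℕ) < t.arity → s i = s' i) :
    Included G t s t' s'' ↔ Included G t s' t' s'' :=
  forall_congr' fun i => forall_congr' fun hi => by rw [t.cherry_congr G h, h i hi]

theorem included_congr_right (G : SimpleGraph V) {t t' : Shape} {s s' s'' : Fin 5 → V}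
    (h : ∀ i : Fin 5, (i : ℕ) < t.arity → s i = s' i) :
    Included G t' s'' t s ↔ Included G t' s'' t s' := by
  unfold Included
  rw [t.contains_congr h]

theorem before_congr_right [LT V] {t t' : Shape} {s s' s'' : Fin 5 → V}
    (h : ∀ i : Fin 5, (i : ℕ) < t.arity → s i = s' i) :
    Before t' s'' t s ↔ Before t' s'' t s' := by
  refine or_congr_right (and_congr_right fun hb => ?_)
  obtain rfl := index_injective hb
  refine exists_congr fun i => and_congr_right fun hi => ?_
  rw [h i hi]
  exact and_congr_left fun _ => forall_congr' fun j => forall_congr' fun hj => by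
    rw [h j (hi.trans' hj)]

theorem isSelected_congr [LT V] (G : SimpleGraph V) (t : Shape) {s s' : Fin 5 → V}
    (h : ∀ i : Fin 5, (i : ℕ) < t.arity → s i = s' i) : t.IsSelected G s ↔ t.IsSelected G s' :=
  and_congr (isCandidate_congr G t h) (forall_congr' fun _ => forall_congr' fun _ =>
    imp_congr_right fun _ => imp_congr (included_congr_left G h)
      (and_congr (included_congr_right G h) (not_congr (before_congr_right h))))

/-- If the distinct values of `s` at the positions below `k` are among those of `f`, then all values
of `f` can be listed in such a way that the list begins with those of `s`. -/
theorem exists_extension_comp_eq {m k : ℕ} {s f : Fin m → V}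
    (hs : ∀ i j : Fin m, i < j → (j : ℕ) < k → s i ≠ s j)
    (hf : ∀ i : Fin m, (i : ℕ) < k → s i ∈ Set.range f) :
    ∃ (e : Fin m → V) (ρ : Fin m → Fin m), (∀ i : Fin m, (i : ℕ) < k → e i = s i) ∧ f = e ∘ ρ := by
  classical
  let A : Finset V := (Finset.univ.filter fun i : Fin m => (i : ℕ) < k).image s
  let B : Finset V := Finset.univ.image f
  let I : Finset (Fin m) := Finset.univ.filter fun i : Fin m => ¬ (i : ℕ) < k
  have hA : A.card = (Finset.univ.filter fun i : Fin m => (i : ℕ) < k).card := by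
    refine Finset.card_image_of_injOn fun i hi j hj h => ?_
    simp only [Finset.coe_filter, Finset.mem_univ, true_and, Set.mem_ofPred_eq] at hi hj
    rcases lt_trichotomy i j with hlt | rfl | hlt
    · exact (hs i j hlt hj h).elim
    · rfl
    · exact (hs j i hlt hi h.symm).elim
  have hAB : A ⊆ B := by
    intro a ha
    obtain ⟨i, hi, rfl⟩ := Finset.mem_image.1 ha
    obtain ⟨j, hj⟩ := hf i (Finset.mem_filter.1 hi).2
    exact Finset.mem_image.2 ⟨j, Finset.mem_univ j, hj⟩
  have hcard : (B \ A).card ≤ I.card := by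
    have h1 : B.card ≤ m := Finset.card_image_le.trans (by simp)
    have h2 := Finset.card_sdiff_add_card_eq_card hAB
    have h3 := Finset.card_filter_add_card_filter_not (s := (Finset.univ : Finset (Fin m)))
      (fun i : Fin m => (i : ℕ) < k)
    simp only [Finset.card_univ, Fintype.card_fin] at h3
    change _ + I.card = m at h3
    omega
  -- The positions from `k` on suffice for the other values.
  obtain ⟨φ⟩ : Nonempty ({x // x ∈ B \ A} ↪ {i // i ∈ I}) :=
    Function.Embedding.nonempty_of_card_le (by simpa using hcard)
  let e : Fin m → V := fun i =>
    if (i : ℕ) < k then s i else if h : ∃ b, (φ b : Fin m) = i then (h.choose : V) else s i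
  have he : ∀ x, ∃ j, f x = e j := by
    intro x
    by_cases hx : f x ∈ A
    · obtain ⟨i, hi, hsi⟩ := Finset.mem_image.1 hx
      exact ⟨i, by simp [e, (Finset.mem_filter.1 hi).2, hsi]⟩
    · let b : {x // x ∈ B \ A} :=
        ⟨f x, Finset.mem_sdiff.2 ⟨Finset.mem_image_of_mem f (Finset.mem_univ x), hx⟩⟩
      have hb : ∃ b', (φ b' : Fin m) = φ b := ⟨b, rfl⟩
      have hI : ¬ ((φ b : Fin m) : ℕ) < k := (Finset.mem_filter.1 (φ b).2).2
      refine ⟨φ b, ?_⟩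
      have : hb.choose = b := φ.injective (Subtype.ext hb.choose_spec)
      simp only [e, if_neg hI, dif_pos hb, this, b]
  choose ρ hρ using he
  exact ⟨e, ρ, fun i hi => if_pos hi, funext hρ⟩

/-- In the definition of `IsSelected`, it suffices to consider the candidates with parameters from
an extension `e` of `s` to five vertices: the parameters of a candidate are centers of its cherries,
and hence they are parameters of every shape in which it is included. -/
theorem isSelected_iff [LT V] {G : SimpleGraph V} {t : Shape} {s : Fin 5 → V} :
    t.IsSelected G s ↔ ∀ e : Fin 5 → V, (∀ i : Fin 5, (i : ℕ) < t.arity → e i = s i) →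
      t.IsCandidate G e ∧ ∀ (t' : Shape) (ρ : Fin 5 → Fin 5), t'.IsCandidate G (e ∘ ρ) →
        Included G t e t' (e ∘ ρ) → Included G t' (e ∘ ρ) t e ∧ ¬ Before t' (e ∘ ρ) t e := by
  constructor
  · intro h e he
    have := (isSelected_congr G t he).2 h
    exact ⟨this.1, fun t' ρ => this.2 t' _⟩
  · intro h
    refine ⟨(h s fun _ _ => rfl).1, fun t' s' hs' hi => ?_⟩
    obtain ⟨hd, hc⟩ := (h s fun _ _ => rfl).1
    obtain ⟨e, ρ, he, rfl⟩ := exists_extension_comp_eq (f := s') hd fun i hi' => by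
      obtain ⟨a, b, hab⟩ := hc i hi'
      obtain ⟨j, -, hj⟩ := t'.exists_eq_of_contains (hi i hi' a b hab)
      exact ⟨j, hj.symm⟩
    rw [← included_congr_right G he, ← before_congr_right he]
    exact (h e he).2 t' ρ hs' ((included_congr_left G he).2 hi)

end Shape

/-! ### Formulas about shapes -/

namespace RAM.Formula

variable {V : Type*} [LinearOrder V] (G : SimpleGraph V)

/-- The formula `i = j`. -/
def eq (i j : ℕ) : Formula := and (not (lt i j)) (not (lt j i))

/-- Disjunction. -/
def or (φ ψ : Formula) : Formula := not (and (not φ) (not ψ))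

/-- Implication. -/
def imp (φ ψ : Formula) : Formula := not (and φ (not ψ))

/-- The existential quantifier. -/
def ex (φ : Formula) : Formula := not (all (not φ))

/-- The conjunction of a list of formulas; the empty one is the true formula `¬ 0 < 0`. -/
def conj : List Formula → Formula
  | [] => not (lt 0 0)
  | φ :: L => and φ (conj L)

/-- The conjunction of the formulas `φ i` with `i < m`. -/
def conjLT (m : ℕ) (φ : Fin 5 → Formula) : Formula :=
  conj (((List.finRange 5).filter fun i : Fin 5 => (i : ℕ) < m).map φ)

/-- A block of `j` universal quantifiers. -/
def alls : ℕ → Formula → Formula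
  | 0, φ => φ
  | j + 1, φ => all (alls j φ)

@[simp] theorem realize_adj {i j k : ℕ} {e : ℕ → V} :
    (adj i j).Realize G k e ↔ G.Adj (e i) (e j) := Iff.rfl

@[simp] theorem realize_lt {i j k : ℕ} {e : ℕ → V} :
    (lt i j).Realize G k e ↔ e i < e j := Iff.rfl

@[simp] theorem realize_not {φ : Formula} {k : ℕ} {e : ℕ → V} :
    (not φ).Realize G k e ↔ ¬ φ.Realize G k e := Iff.rfl

@[simp] theorem realize_and {φ ψ : Formula} {k : ℕ} {e : ℕ → V} :
    (and φ ψ).Realize G k e ↔ φ.Realize G k e ∧ ψ.Realize G k e := Iff.rfl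

@[simp] theorem realize_all {φ : Formula} {k : ℕ} {e : ℕ → V} :
    (all φ).Realize G k e ↔ ∀ w, φ.Realize G (k + 1) (Function.update e k w) := Iff.rfl

@[simp] theorem realize_eq {i j k : ℕ} {e : ℕ → V} : (eq i j).Realize G k e ↔ e i = e j := by
  simp [eq, le_antisymm_iff, and_comm]

@[simp] theorem realize_or {φ ψ : Formula} {k : ℕ} {e : ℕ → V} :
    (or φ ψ).Realize G k e ↔ φ.Realize G k e ∨ ψ.Realize G k e := by
  simp [or, or_iff_not_imp_left]

@[simp] theorem realize_imp {φ ψ : Formula} {k : ℕ} {e : ℕ → V} :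
    (imp φ ψ).Realize G k e ↔ (φ.Realize G k e → ψ.Realize G k e) := by
  simp [imp]

@[simp] theorem realize_ex {φ : Formula} {k : ℕ} {e : ℕ → V} :
    (ex φ).Realize G k e ↔ ∃ w, φ.Realize G (k + 1) (Function.update e k w) := by
  simp [ex]

@[simp] theorem realize_conj {L : List Formula} {k : ℕ} {e : ℕ → V} :
    (conj L).Realize G k e ↔ ∀ φ ∈ L, φ.Realize G k e := by
  induction L <;> simp_all [conj]

@[simp] theorem realize_conjLT {m : ℕ} {φ : Fin 5 → Formula} {k : ℕ} {e : ℕ → V} :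
    (conjLT m φ).Realize G k e ↔ ∀ i : Fin 5, (i : ℕ) < m → (φ i).Realize G k e := by
  simp [conjLT]

theorem realize_alls {φ : Formula} {j k : ℕ} {e : ℕ → V} :
    (alls j φ).Realize G k e ↔
      ∀ f : ℕ → V, (∀ i, i < k ∨ k + j ≤ i → f i = e i) → φ.Realize G (k + j) f := by
  induction j generalizing k e with
  | zero =>
    refine ⟨fun h f hf => ?_, fun h => h e fun _ _ => rfl⟩
    rwa [funext fun i => hf i (by omega)]
  | succ j ih =>
    simp only [alls, realize_all, ih, show k + 1 + j = k + (j + 1) by omega]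
    constructor
    · intro h f hf
      refine h (f k) f fun i hi => ?_
      by_cases hik : i = k
      · simp [hik]
      · rw [Function.update_of_ne hik, hf i (by omega)]
    · intro h w f hf
      refine h f fun i hi => ?_
      rw [hf i (by omega), Function.update_of_ne (by omega)]

theorem closed_conj {L : List Formula} {k : ℕ} (hk : 0 < k) (h : ∀ φ ∈ L, φ.Closed k) :
    (conj L).Closed k := by
  induction L <;> simp_all [conj, Closed]

theorem closed_conjLT {m : ℕ} {φ : Fin 5 → Formula} {k : ℕ} (hk : 0 < k)
    (h : ∀ i : Fin 5, (i : ℕ) < m → (φ i).Closed k) : (conjLT m φ).Closed k :=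
  closed_conj hk (by simpa using h)

theorem closed_alls {φ : Formula} {j k : ℕ} (h : φ.Closed (k + j)) : (alls j φ).Closed k := by
  induction j generalizing k with
  | zero => exact h
  | succ j ih => exact ih (by rwa [show k + 1 + j = k + (j + 1) by omega])

theorem depth_conj {L : List Formula} {d : ℕ} (h : ∀ φ ∈ L, φ.depth ≤ d) : (conj L).depth ≤ d := by
  induction L <;> simp_all [conj, depth]

theorem depth_conjLT {m : ℕ} {φ : Fin 5 → Formula} {d : ℕ}
    (h : ∀ i : Fin 5, (φ i).depth ≤ d) : (conjLT m φ).depth ≤ d :=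
  depth_conj (by simpa using fun i _ => h i)

theorem depth_alls {φ : Formula} {j : ℕ} : (alls j φ).depth = φ.depth + j := by
  induction j <;> simp_all [alls, depth]; omega

/-- The formula for `IsPair`. -/
def isPair (p q a b : ℕ) : Formula := or (and (eq a p) (eq b q)) (and (eq a q) (eq b p))

/-- The formula for `OnEdge`. -/
def onEdge (p q c a b : ℕ) : Formula :=
  or (and (eq c p) (or (eq a q) (eq b q))) (and (eq c q) (or (eq a p) (eq b p)))

/-- The formula for `StarShape`. -/
def starShape (u v z x y c a b : ℕ) : Formula :=
  or (eq c u) (or (onEdge u v c a b) (or (onEdge u z c a b)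
    (or (and (eq c x) (isPair u v a b)) (and (eq c y) (isPair u z a b)))))

/-- The formula for `FanShape`. -/
def fanShape (u v z x c a b : ℕ) : Formula :=
  or (onEdge u v c a b) (or (onEdge u z c a b) (or (and (eq c v) (or (eq a z) (eq b z)))
    (and (eq c x) (or (isPair u v a b) (isPair v z a b)))))

/-- The formula for `KiteShape`. -/
def kiteShape (u v z x c a b : ℕ) : Formula :=
  or (onEdge u v c a b) (or (onEdge u z c a b) (or (and (eq c u) (or (eq a x) (eq b x)))
    (or (and (eq c v) (isPair x z a b)) (and (eq c x) (or (isPair u v a b) (isPair v z a b))))))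

/-- The formula that `a` is one of `u`, `v`, `z`, `x`. -/
def oneOf (u v z x a : ℕ) : Formula := or (eq a u) (or (eq a v) (or (eq a z) (eq a x)))

/-- The formula for `TetraShape`. -/
def tetraShape (u v z x c a b : ℕ) : Formula :=
  or (onEdge u v c a b) (or (onEdge u z c a b)
    (and (oneOf u v z x c) (and (oneOf u v z x a) (oneOf u v z x b))))

/-- The formula for `Shape.Contains`; the parameters are the variables `ρ 0, …, ρ 4`. -/
def contains (ρ : Fin 5 → Fin 5) (c a b : ℕ) : Shape → Formula
  | .empty => lt 0 0
  | .star₁ => starShape (ρ 0) (ρ 0) (ρ 0) (ρ 0) (ρ 0) c a b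
  | .star₂ => starShape (ρ 0) (ρ 1) (ρ 0) (ρ 0) (ρ 0) c a b
  | .star₃ => starShape (ρ 0) (ρ 1) (ρ 0) (ρ 2) (ρ 0) c a b
  | .star₃' => starShape (ρ 0) (ρ 1) (ρ 2) (ρ 0) (ρ 0) c a b
  | .star₄ => starShape (ρ 0) (ρ 1) (ρ 2) (ρ 3) (ρ 0) c a b
  | .star₅ => starShape (ρ 0) (ρ 1) (ρ 2) (ρ 3) (ρ 4) c a b
  | .fan₃ => fanShape (ρ 0) (ρ 1) (ρ 2) (ρ 0) c a b
  | .fan₄ => fanShape (ρ 0) (ρ 1) (ρ 2) (ρ 3) c a b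
  | .kite => kiteShape (ρ 0) (ρ 1) (ρ 2) (ρ 3) c a b
  | .tetra => tetraShape (ρ 0) (ρ 1) (ρ 2) (ρ 3) c a b

/-- The values of the first five variables. -/
def params (e : ℕ → V) : Fin 5 → V := fun i => e i

@[simp] theorem realize_contains {ρ : Fin 5 → Fin 5} {c a b : ℕ} {t : Shape} {k : ℕ} {e : ℕ → V} :
    (contains ρ c a b t).Realize G k e ↔ t.Contains (params e ∘ ρ) (e c) (e a) (e b) := by
  cases t <;>
    simp [contains, Shape.Contains, starShape, StarShape, fanShape, FanShape, kiteShape, KiteShape,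
      tetraShape, TetraShape, onEdge, OnEdge, isPair, IsPair, oneOf, params]

theorem closed_contains {ρ : Fin 5 → Fin 5} {c a b : ℕ} {t : Shape} {k : ℕ} (hc : c < k)
    (ha : a < k) (hb : b < k) (hρ : ∀ i : Fin 5, (i : ℕ) < t.arity → (ρ i : ℕ) < k) :
    (contains ρ c a b t).Closed k := by
  have hk : 0 < k := by omega
  cases t <;> simp [Fin.forall_fin_succ, Shape.arity] at hρ <;>
    simp [contains, starShape, fanShape, kiteShape, tetraShape, onEdge, isPair, oneOf, Closed, eq,
      or, *]

theorem depth_contains {ρ : Fin 5 → Fin 5} {c a b : ℕ} {t : Shape} :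
    (contains ρ c a b t).depth = 0 := by
  cases t <;> rfl

/-- The formula for `Shape.Cherry`. -/
def cherry (ρ : Fin 5 → Fin 5) (c a b : ℕ) (t : Shape) : Formula :=
  and (adj c a) (and (adj c b) (and (not (eq a b)) (contains ρ c a b t)))

@[simp] theorem realize_cherry {ρ : Fin 5 → Fin 5} {c a b : ℕ} {t : Shape} {k : ℕ} {e : ℕ → V} :
    (cherry ρ c a b t).Realize G k e ↔ t.Cherry G (params e ∘ ρ) (e c) (e a) (e b) := by
  simp [cherry, Shape.Cherry]

theorem closed_cherry {ρ : Fin 5 → Fin 5} {c a b : ℕ} {t : Shape} {k : ℕ} (hc : c < k) (ha : a < k)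
    (hb : b < k) (hρ : ∀ i : Fin 5, (i : ℕ) < t.arity → (ρ i : ℕ) < k) :
    (cherry ρ c a b t).Closed k := by
  exact ⟨⟨hc, ha⟩, ⟨hc, hb⟩, ⟨⟨ha, hb⟩, hb, ha⟩, closed_contains hc ha hb hρ⟩

theorem depth_cherry {ρ : Fin 5 → Fin 5} {c a b : ℕ} {t : Shape} :
    (cherry ρ c a b t).depth = 0 := by
  simp [cherry, depth, eq, depth_contains]

/-- The formula for `Shape.IsCandidate` at level `5`, at which the first five variables are the
possible parameters. -/
def isCandidate (ρ : Fin 5 → Fin 5) (t : Shape) : Formula :=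
  and (conjLT t.arity fun j => conjLT j fun i => not (eq (ρ i) (ρ j)))
    (conjLT t.arity fun i => ex (ex (cherry ρ (ρ i) 5 6 t)))

/-- The formula for `Shape.Included` at level `5`. -/
def included (ρ : Fin 5 → Fin 5) (t : Shape) (ρ' : Fin 5 → Fin 5) (t' : Shape) : Formula :=
  conjLT t.arity fun i => all (all (imp (cherry ρ (ρ i) 5 6 t) (contains ρ' (ρ i) 5 6 t')))

/-- The formula for `Shape.Before`. -/
def before (ρ : Fin 5 → Fin 5) (t : Shape) (ρ' : Fin 5 → Fin 5) (t' : Shape) : Formula :=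
  if t.index < t'.index then not (lt 0 0)
  else if t.index = t'.index then
    not (conjLT t.arity fun i => not (and (conjLT i fun j => eq (ρ j) (ρ' j)) (lt (ρ i) (ρ' i))))
  else lt 0 0

theorem params_update {V : Type*} (e : ℕ → V) (a b : V) :
    params (Function.update (Function.update e 5 a) (5 + 1) b) = params e := by
  funext i
  have := i.2
  rw [params, params, Function.update_of_ne (by omega), Function.update_of_ne (by omega)]

@[simp] theorem realize_isCandidate {ρ : Fin 5 → Fin 5} {t : Shape} {e : ℕ → V} :
    (isCandidate ρ t).Realize G 5 e ↔ t.IsCandidate G (params e ∘ ρ) := by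
  simp only [isCandidate, realize_and, realize_conjLT, realize_not, realize_eq, realize_ex,
    realize_cherry, Shape.IsCandidate, Shape.Distinct]
  refine and_congr ?_ ?_
  · exact ⟨fun h i j hij hj => h j hj i hij, fun h j hj i hij => h i j hij hj⟩
  · refine forall_congr' fun i => imp_congr_right fun _ =>
      exists_congr fun a => exists_congr fun b => ?_
    have := (ρ i).2
    rw [Function.update_of_ne (by omega), Function.update_of_ne (by omega)]
    rw [params_update]
    simp [params]

@[simp] theorem realize_included {ρ ρ' : Fin 5 → Fin 5} {t t' : Shape} {e : ℕ → V} :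
    (included ρ t ρ' t').Realize G 5 e ↔
      Shape.Included G t (params e ∘ ρ) t' (params e ∘ ρ') := by
  simp only [included, realize_conjLT, realize_all, realize_imp, realize_contains,
    realize_cherry, Shape.Included]
  refine forall_congr' fun i => imp_congr_right fun _ =>
    forall_congr' fun a => forall_congr' fun b => ?_
  have := (ρ i).2
  rw [params_update, Function.update_of_ne (by omega : (ρ i : ℕ) ≠ 5 + 1),
    Function.update_of_ne (by omega : (ρ i : ℕ) ≠ 5)]
  simp [params]

@[simp] theorem realize_before {ρ ρ' : Fin 5 → Fin 5} {t t' : Shape} {k : ℕ} {e : ℕ → V} :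
    (before ρ t ρ' t').Realize G k e ↔
      Shape.Before t (params e ∘ ρ) t' (params e ∘ ρ') := by
  unfold before Shape.Before
  split_ifs with h1 h2
  · simp [h1]
  · simp [h2, params]
  · simp [h1, h2]

/-- The list of all maps from the five positions to themselves. -/
def maps : List (Fin 5 → Fin 5) := List.ofFn (finFunctionFinEquiv (m := 5) (n := 5)).symm

theorem mem_maps (ρ : Fin 5 → Fin 5) : ρ ∈ maps :=
  List.mem_ofFn.2 (finFunctionFinEquiv.symm.surjective ρ)

-- The list has `5 ^ 5` entries and must not be unfolded.
attribute [irreducible] maps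

/-- The formula for the condition in `Shape.isSelected_iff` at level `5`. -/
def isSelected (t : Shape) : Formula :=
  and (isCandidate id t) (conj (Shape.all.flatMap fun t' => maps.map fun ρ =>
      imp (isCandidate ρ t') (imp (included id t ρ t')
        (and (included ρ t' id t) (not (before ρ t' id t))))))

theorem realize_isSelected {t : Shape} {e : ℕ → V} :
    (isSelected t).Realize G 5 e ↔ t.IsCandidate G (params e) ∧
      ∀ (t' : Shape) (ρ : Fin 5 → Fin 5), t'.IsCandidate G (params e ∘ ρ) →
        Shape.Included G t (params e) t' (params e ∘ ρ) →
        Shape.Included G t' (params e ∘ ρ) t (params e) ∧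
          ¬ Shape.Before t' (params e ∘ ρ) t (params e) := by
  simp only [isSelected, realize_and, realize_isCandidate, Function.comp_id, realize_conj,
    List.mem_flatMap, List.mem_map]
  refine and_congr_right fun _ => ⟨fun h t' ρ => ?_, ?_⟩
  · simpa using h _ ⟨t', Shape.mem_all t', ρ, mem_maps ρ, rfl⟩
  · rintro h _ ⟨t', -, ρ, -, rfl⟩
    simpa using h t' ρ

theorem closed_isCandidate (ρ : Fin 5 → Fin 5) (t : Shape) : (isCandidate ρ t).Closed 5 := by
  refine ⟨closed_conjLT (by simp) fun j _ => closed_conjLT (by simp) fun i _ => ?_,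
    closed_conjLT (by simp) fun i _ => ?_⟩
  · simp [Closed, eq]
  · exact closed_cherry (by omega) (by simp) (by simp) fun i _ => by omega

theorem closed_included (ρ : Fin 5 → Fin 5) (t : Shape) (ρ' : Fin 5 → Fin 5) (t' : Shape) :
    (included ρ t ρ' t').Closed 5 :=
  closed_conjLT (by simp) fun i _ =>
    ⟨closed_cherry (by omega) (by simp) (by simp) fun i _ => by omega,
      closed_contains (by omega) (by simp) (by simp) fun i _ => by omega⟩

theorem closed_before (ρ : Fin 5 → Fin 5) (t : Shape) (ρ' : Fin 5 → Fin 5) (t' : Shape) :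
    (before ρ t ρ' t').Closed 5 := by
  unfold before
  split_ifs
  · simp [Closed]
  · rw [Closed]
    exact closed_conjLT (by simp) fun i _ =>
      ⟨closed_conjLT (by simp) fun j _ => by simp only [Closed, eq]; omega, ⟨by omega, by omega⟩⟩
  · simp [Closed]

theorem closed_isSelected (t : Shape) : (isSelected t).Closed 5 := by
  rw [isSelected, Closed]
  refine ⟨closed_isCandidate id t, closed_conj (by norm_num) fun φ hφ => ?_⟩
  simp only [List.mem_flatMap, List.mem_map] at hφ
  obtain ⟨t', -, ρ, -, rfl⟩ := hφ
  exact ⟨closed_isCandidate ρ t', closed_included id t ρ t', closed_included ρ t' id t,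
    closed_before ρ t' id t⟩

theorem depth_isCandidate (ρ : Fin 5 → Fin 5) (t : Shape) : (isCandidate ρ t).depth ≤ 2 := by
  refine max_le (depth_conjLT fun j => depth_conjLT fun i => ?_) (depth_conjLT fun i => ?_)
  · simp [depth, eq]
  · simp [depth, ex, depth_cherry]

theorem depth_included (ρ : Fin 5 → Fin 5) (t : Shape) (ρ' : Fin 5 → Fin 5) (t' : Shape) :
    (included ρ t ρ' t').depth ≤ 2 :=
  depth_conjLT fun i => by simp [depth, imp, depth_cherry, depth_contains]

theorem depth_before (ρ : Fin 5 → Fin 5) (t : Shape) (ρ' : Fin 5 → Fin 5) (t' : Shape) :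
    (before ρ t ρ' t').depth ≤ 2 := by
  unfold before
  split_ifs
  · simp [depth]
  · rw [depth]
    exact depth_conjLT fun i => max_le (depth_conjLT fun j => by simp [depth, eq]) (by simp [depth])
  · simp [depth]

theorem depth_isSelected (t : Shape) : (isSelected t).depth ≤ 2 := by
  rw [isSelected, depth]
  refine max_le (depth_isCandidate id t) (depth_conj fun φ hφ => ?_)
  simp only [List.mem_flatMap, List.mem_map] at hφ
  obtain ⟨t', -, ρ, -, rfl⟩ := hφ
  exact max_le (depth_isCandidate ρ t') (max_le (depth_included id t ρ t')
    (max_le (depth_included ρ t' id t) (depth_before ρ t' id t)))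

end RAM.Formula

/-! ### The program -/

namespace RAM.Command

/-- The commands of a list, one after the other. -/
def seqs : List Command → Command
  | [] => skip
  | c :: L => seq c (seqs L)

/-- A block of `j` nested loops. -/
def eachs : ℕ → Command → Command
  | 0, c => c
  | j + 1, c => each (eachs j c)

/-- The assignments that differ from `e` at most at the variables `k, …, k + j - 1`, in the order
in which nested loops run through them. -/
def extensions {n : ℕ} : ℕ → ℕ → (ℕ → Fin n) → List (ℕ → Fin n)
  | 0, _, e => [e]
  | j + 1, k, e => (List.finRange n).flatMap fun w => extensions j (k + 1) (Function.update e k w)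

theorem mem_extensions {n j k : ℕ} {e f : ℕ → Fin n} :
    f ∈ extensions j k e ↔ ∀ i, i < k ∨ k + j ≤ i → f i = e i := by
  induction j generalizing k e with
  | zero =>
    simp only [extensions, List.mem_singleton]
    exact ⟨fun h i _ => congrFun h i, fun h => funext fun i => h i (by omega)⟩
  | succ j ih =>
    simp only [extensions, List.mem_flatMap, List.mem_finRange, true_and, ih]
    constructor
    · rintro ⟨w, h⟩ i hi
      rw [h i (by omega), Function.update_of_ne (by omega)]
    · intro h
      refine ⟨f k, fun i hi => ?_⟩
      by_cases hik : i = k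
      · simp [hik]
      · rw [Function.update_of_ne hik, h i (by omega)]

theorem nodup_extensions {n j k : ℕ} {e : ℕ → Fin n} : (extensions j k e).Nodup := by
  induction j generalizing k e with
  | zero => simp [extensions]
  | succ j ih =>
    refine List.nodup_flatMap.2 ⟨fun _ _ => ih, (List.nodup_finRange n).imp fun {w w'} hw => ?_⟩
    intro f hf hf'
    have h := mem_extensions.1 hf k (by omega)
    have h' := mem_extensions.1 hf' k (by omega)
    simp only [Function.update_self] at h h'
    exact hw (h.symm.trans h')

theorem output_seqs {n : ℕ} (G : SimpleGraph (Fin n)) (L : List Command) (k : ℕ) (e : ℕ → Fin n) :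
    (seqs L).output G k e = L.flatMap fun c => c.output G k e := by
  induction L <;> simp_all [seqs, output]

theorem output_eachs {n : ℕ} (G : SimpleGraph (Fin n)) (c : Command) (j k : ℕ) (e : ℕ → Fin n) :
    (eachs j c).output G k e = (extensions j k e).flatMap (c.output G (k + j)) := by
  induction j generalizing k e with
  | zero => simp [eachs, extensions]
  | succ j ih =>
    simp only [eachs, output, extensions, ih, List.flatMap_assoc,
      show k + 1 + j = k + (j + 1) by omega]

theorem closed_seqs {L : List Command} {k : ℕ} (h : ∀ c ∈ L, c.Closed k) : (seqs L).Closed k := by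
  induction L <;> simp_all [seqs, Closed]

theorem closed_eachs {c : Command} {j k : ℕ} (h : c.Closed (k + j)) : (eachs j c).Closed k := by
  induction j generalizing k with
  | zero => exact h
  | succ j ih => exact ih (by rwa [show k + 1 + j = k + (j + 1) by omega])

theorem depth_seqs {L : List Command} {d : ℕ} (h : ∀ c ∈ L, c.depth ≤ d) : (seqs L).depth ≤ d := by
  induction L <;> simp_all [seqs, depth]

theorem depth_eachs {c : Command} {j : ℕ} : (eachs j c).depth = c.depth + j := by
  induction j <;> simp_all [eachs, depth]; omega

/-- The command that writes the cherries of the shape with parameters `0, 1, …` and center `i`, each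
as a pair of edges, where `j` is the number of loops around the command. -/
def writeCherries (t : Shape) (i j : ℕ) : Command :=
  each (each (test (.and (.lt j (j + 1)) (.cherry id i j (j + 1) t))
    (seq (put i) (seq (put j) (seq (put i) (put (j + 1)))))))

/-- The command that writes the complement of the completion for the shape with parameters
`0, 1, …`, inside of as many loops as there are parameters. -/
def writeCompletion (t : Shape) : Command :=
  seq (seqs (((List.finRange 5).filter fun i : Fin 5 => (i : ℕ) < t.arity).map fun i : Fin 5 =>
    writeCherries t i t.arity)) putSize

/-- The command that writes the complements of all minimal completions. The test has
`5 - t.arity` quantifiers for an extension of the parameters to five vertices. -/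
def writeAll : Command :=
  seqs (Shape.all.map fun t => eachs t.arity
    (test (.alls (5 - t.arity) (.isSelected t)) (writeCompletion t)))

theorem _root_.Shape.arity_le (t : Shape) : t.arity ≤ 5 := by
  cases t <;> simp [Shape.arity]

theorem closed_writeAll : writeAll.Closed 0 := by
  refine closed_seqs fun c hc => ?_
  obtain ⟨t, -, rfl⟩ := List.mem_map.1 hc
  have ht := t.arity_le
  refine closed_eachs ⟨Formula.closed_alls ?_, closed_seqs fun c hc => ?_, trivial⟩
  · rw [show 0 + t.arity + (5 - t.arity) = 5 by omega]
    exact Formula.closed_isSelected t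
  · obtain ⟨i, hi, rfl⟩ := List.mem_map.1 hc
    have hi : (i : ℕ) < t.arity := by simpa using hi
    refine ⟨⟨⟨by omega, by omega⟩, Formula.closed_cherry (by omega) (by omega) (by omega) ?_⟩, ?_⟩
    · exact fun i hi => by simp only [id]; omega
    · simp only [Closed]; omega

/-- The loops and quantifiers are nested `7` deep: for five vertices, of which the first ones are
the parameters, and the two ends of a cherry. -/
theorem depth_writeAll : writeAll.depth ≤ 7 := by
  refine depth_seqs fun c hc => ?_
  obtain ⟨t, -, rfl⟩ := List.mem_map.1 hc
  have ht := t.arity_le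
  have h := Formula.depth_isSelected t
  have h' : (writeCompletion t).depth ≤ 2 := by
    refine max_le (depth_seqs fun c hc => ?_) (by simp [depth])
    obtain ⟨i, -, rfl⟩ := List.mem_map.1 hc
    simp [writeCherries, depth, Formula.depth, Formula.depth_cherry]
  rw [depth_eachs, depth, Formula.depth_alls]
  omega

end RAM.Command

/-! ### Correctness of the output -/

namespace Shape

variable {n : ℕ} (G : SimpleGraph (Fin n))

open Classical in
/-- The cherries with center `c` of a shape, as a list of pairs of edges. -/
noncomputable def cherryList (t : Shape) (s : Fin 5 → Fin n) (c : Fin n) : List (EdgePair n) :=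
  (List.finRange n).flatMap fun a => (List.finRange n).flatMap fun b =>
    if a < b ∧ t.Cherry G s c a b then [((c, a), (c, b))] else []

/-- The cherries of a shape, as a list of pairs of edges. -/
noncomputable def pairList (t : Shape) (s : Fin 5 → Fin n) : List (EdgePair n) :=
  ((List.finRange 5).filter fun i : Fin 5 => (i : ℕ) < t.arity).flatMap fun i =>
    cherryList G t s (s i)

theorem mem_cherryList {t : Shape} {s : Fin 5 → Fin n} {c : Fin n} {q : EdgePair n} :
    q ∈ cherryList G t s c ↔ ∃ a b, a < b ∧ t.Cherry G s c a b ∧ q = ((c, a), (c, b)) := by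
  simp only [cherryList, List.mem_flatMap, List.mem_finRange, true_and, List.mem_ite_nil_right,
    List.mem_singleton, and_assoc]

theorem nodup_cherryList {t : Shape} {s : Fin 5 → Fin n} {c : Fin n} :
    (cherryList G t s c).Nodup := by
  refine List.nodup_flatMap.2 ⟨fun a _ => List.nodup_flatMap.2 ⟨fun b _ => ?_, ?_⟩, ?_⟩
  · split_ifs <;> simp
  · refine (List.nodup_finRange n).imp fun {b b'} hb q hq hq' => hb ?_
    simp only [List.mem_ite_nil_right, List.mem_singleton] at hq hq'
    simpa using hq.2.symm.trans hq'.2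
  · refine (List.nodup_finRange n).imp fun {a a'} ha q hq hq' => ha ?_
    simp only [List.mem_flatMap, List.mem_ite_nil_right, List.mem_singleton] at hq hq'
    obtain ⟨b, -, -, rfl⟩ := hq
    obtain ⟨b', -, -, h⟩ := hq'
    simp only [Prod.mk.injEq] at h
    exact h.1.2

theorem mem_pairList {t : Shape} {s : Fin 5 → Fin n} {q : EdgePair n} :
    q ∈ pairList G t s ↔ ∃ c a b, a < b ∧ t.Cherry G s c a b ∧ q = ((c, a), (c, b)) := by
  simp only [pairList, List.mem_flatMap, List.mem_filter, List.mem_finRange, true_and,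
    decide_eq_true_eq, mem_cherryList]
  constructor
  · rintro ⟨i, -, a, b, h⟩
    exact ⟨s i, a, b, h⟩
  · rintro ⟨c, a, b, hab, hc, rfl⟩
    obtain ⟨i, hi, rfl⟩ := t.exists_eq_of_contains hc.2.2.2
    exact ⟨i, hi, a, b, hab, hc, rfl⟩

theorem nodup_pairList {t : Shape} {s : Fin 5 → Fin n} (h : t.Distinct s) :
    (pairList G t s).Nodup := by
  refine List.nodup_flatMap.2 ⟨fun i _ => nodup_cherryList G, ?_⟩
  refine List.Pairwise.imp_of_mem (R := (· ≠ ·)) (fun {i j} hi hj hij q hq hq' => hij ?_)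
    ((List.nodup_finRange 5).filter _)
  simp only [List.mem_filter, List.mem_finRange, true_and, decide_eq_true_eq] at hi hj
  obtain ⟨a, b, -, -, rfl⟩ := (mem_cherryList G).1 hq
  obtain ⟨a', b', -, -, h'⟩ := (mem_cherryList G).1 hq'
  simp only [Prod.mk.injEq] at h'
  exact (h.apply_eq_iff hi hj).1 h'.1.1

theorem listsEdges_pairList {t : Shape} {s : Fin 5 → Fin n} (h : t.Distinct s) :
    ListsEdges (pairList G t s) (t.completion G s)ᶜ := by
  rw [completion, compl_compl]
  constructor
  · refine (nodup_pairList G h).map_on fun q hq q' hq' heq => ?_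
    obtain ⟨c, a, b, hab, ⟨hca, hcb, -⟩, rfl⟩ := (mem_pairList G).1 hq
    obtain ⟨c', a', b', hab', ⟨hca', hcb', -⟩, rfl⟩ := (mem_pairList G).1 hq'
    have := hca.ne
    have := hcb.ne
    have := hca'.ne
    have := hcb'.ne
    simp only [EdgePair.toSym2, Sym2.eq_iff] at heq
    simp only [Prod.mk.injEq]
    grind
  · intro z
    simp only [List.mem_map, mem_pairList, Set.mem_image]
    constructor
    · rintro ⟨_, ⟨c, a, b, hab, hc, rfl⟩, rfl⟩
      exact ⟨s(⟨s(c, a), hc.1⟩, ⟨s(c, b), hc.2.1⟩),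
        (cherryGraph_adj_mk hc.1 hc.2.1 hab.ne).2 (.inl hc.2.2.2), rfl⟩
    · rintro ⟨w, hw, rfl⟩
      induction w with | _ e f
      obtain ⟨c, a, b, ha, hb, hab, rfl, rfl⟩ :=
        exists_eq_mk_of_lineGraph_adj (cherryGraph_le_lineGraph G _ hw)
      have hc : t.Contains s c a b :=
        ((cherryGraph_adj_mk ha hb hab).1 hw).elim id t.contains_swap
      rcases lt_or_gt_of_ne hab with hlt | hlt
      · exact ⟨_, ⟨c, a, b, hlt, ⟨ha, hb, hab, hc⟩, rfl⟩, rfl⟩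
      · exact ⟨_, ⟨c, b, a, hlt, ⟨hb, ha, hab.symm, t.contains_swap hc⟩, rfl⟩, Sym2.eq_swap⟩

end Shape

namespace RAM.Command

variable {n : ℕ} (G : SimpleGraph (Fin n))

open Formula (params)

theorem output_writeCompletion (t : Shape) (e : ℕ → Fin n) :
    (writeCompletion t).output G t.arity e = wordsOf (t.pairList G (params e)) := by
  simp only [writeCompletion, output, output_seqs, wordsOf, Shape.pairList, List.flatMap_assoc,
    List.flatMap_map]
  congr 1
  refine List.flatMap_congr fun i hi => ?_
  have hi : (i : ℕ) < t.arity := by simpa using hi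
  simp only [writeCherries, output, Shape.cherryList, List.flatMap_assoc]
  refine List.flatMap_congr fun a _ => List.flatMap_congr fun b _ => ?_
  have hs : t.Cherry G (params (Function.update (Function.update e t.arity a) (t.arity + 1) b)) =
      t.Cherry G (params e) := by
    refine t.cherry_congr G fun i hi => ?_
    rw [params, params, Function.update_of_ne (by omega), Function.update_of_ne (by omega)]
  have hi' : Function.update (Function.update e t.arity a) (t.arity + 1) b i = params e i := by
    rw [params, Function.update_of_ne (by omega), Function.update_of_ne (by omega)]
  have ha : Function.update (Function.update e t.arity a) (t.arity + 1) b t.arity = a := by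
    rw [Function.update_of_ne (by omega), Function.update_self]
  have hb : Function.update (Function.update e t.arity a) (t.arity + 1) b (t.arity + 1) = b :=
    Function.update_self ..
  have hiff : (Formula.and (.lt t.arity (t.arity + 1))
      (.cherry id i t.arity (t.arity + 1) t)).Realize G (t.arity + 1 + 1)
      (Function.update (Function.update e t.arity a) (t.arity + 1) b) ↔
      a < b ∧ t.Cherry G (params e) (params e i) a b := by
    rw [Formula.realize_and, Formula.realize_lt, Formula.realize_cherry, Function.comp_id, hs, hi',
      ha, hb]
  by_cases h : a < b ∧ t.Cherry G (params e) (params e i) a b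
  · simp only [if_pos h, if_pos (hiff.2 h), hi', ha, hb]
    rfl
  · rw [if_neg h, if_neg (mt hiff.1 h)]
    rfl

/-- The test in `writeAll` succeeds if and only if the candidate is selected. -/
theorem realize_alls_isSelected {t : Shape} {e : ℕ → Fin n} :
    (Formula.alls (5 - t.arity) (.isSelected t)).Realize G t.arity e ↔
      t.IsSelected G (params e) := by
  have ht := t.arity_le
  rw [Formula.realize_alls, show t.arity + (5 - t.arity) = 5 by omega, Shape.isSelected_iff]
  constructor
  · intro h s hs
    have hp : params (fun i => if hi : i < 5 then s ⟨i, hi⟩ else e i) = s := by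
      funext i
      simp [params]
    rw [← hp, ← Formula.realize_isSelected]
    refine h _ fun i hi => ?_
    rcases hi with hi | hi
    · rw [dif_pos (by omega)]
      exact hs ⟨i, by omega⟩ hi
    · rw [dif_neg (by omega)]
  · intro h f hf
    rw [Formula.realize_isSelected]
    exact h (params f) fun i hi => hf i (.inl hi)

theorem listsMinimalCompletions_writeAll (e : ℕ → Fin n) :
    ListsMinimalCompletions G (writeAll.output G 0 e) := by
  classical
  have : Nonempty (Fin n) := ⟨e 0⟩
  -- The selected candidates, with the variables beyond the parameters as in `e`.
  let P : List (Shape × (ℕ → Fin n)) := Shape.all.flatMap fun t =>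
    ((extensions t.arity 0 e).filter fun f => t.IsSelected G (params f)).map (Prod.mk t)
  have hP : ∀ t f, (t, f) ∈ P ↔ (∀ i, t.arity ≤ i → f i = e i) ∧ t.IsSelected G (params f) := by
    intro t f
    simp only [P, List.mem_flatMap, List.mem_map, List.mem_filter, mem_extensions,
      decide_eq_true_eq, Prod.mk.injEq]
    constructor
    · rintro ⟨t, -, f, h, rfl, rfl⟩
      exact ⟨fun i hi => h.1 i (by omega), h.2⟩
    · exact fun h => ⟨t, t.mem_all, f, ⟨fun i hi => h.1 i (by omega), h.2⟩, rfl, rfl⟩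
  have hPnodup : P.Nodup := by
    refine List.nodup_flatMap.2 ⟨fun t _ => ?_, Shape.nodup_all.imp fun {t t'} ht x hx hx' => ht ?_⟩
    · exact (nodup_extensions.filter _).map fun f f' h => (Prod.mk.inj h).2
    · obtain ⟨f, -, rfl⟩ := List.mem_map.1 hx
      obtain ⟨f', -, h⟩ := List.mem_map.1 hx'
      exact (Prod.mk.inj h).1.symm
  refine ⟨P.map fun x => (x.1.completion G (params x.2), x.1.pairList G (params x.2)),
    ?_, ?_, ?_, ?_⟩
  · rw [List.map_map]
    refine hPnodup.map_on ?_
    rintro ⟨t, f⟩ hx ⟨t', f'⟩ hx' heq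
    obtain ⟨hf, hs⟩ := (hP t f).1 hx
    obtain ⟨hf', hs'⟩ := (hP t' f').1 hx'
    obtain ⟨rfl, h⟩ := hs.eq_of_completion_eq hs' heq
    refine Prod.ext rfl (funext fun i => ?_)
    by_cases hi : i < t.arity
    · exact h ⟨i, hi.trans_le t.arity_le⟩ hi
    · exact (hf i (by omega)).trans (hf' i (by omega)).symm
  · intro H
    rw [List.map_map, Shape.isMinimalIntervalCompletion_iff_exists_isSelected, List.mem_map]
    constructor
    · rintro ⟨⟨t, f⟩, hx, rfl⟩
      exact ⟨t, params f, ((hP t f).1 hx).2, rfl⟩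
    · rintro ⟨t, s, hs, rfl⟩
      let f : ℕ → Fin n := fun i =>
        if hi : i < t.arity then s ⟨i, hi.trans_le t.arity_le⟩ else e i
      have hf : ∀ i : Fin 5, (i : ℕ) < t.arity → s i = params f i := by
        intro i hi
        simp [params, f, hi]
      refine ⟨(t, f), (hP t f).2 ⟨fun i hi => dif_neg (by omega), ?_⟩, ?_⟩
      · exact (Shape.isSelected_congr G t hf).1 hs
      · simp only [Function.comp, Shape.completion, Shape.contains_congr t hf]
  · intro x hx
    obtain ⟨⟨t, f⟩, htf, rfl⟩ := List.mem_map.1 hx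
    exact Shape.listsEdges_pairList G ((hP t f).1 htf).2.1.1
  · simp only [writeAll, output_seqs, List.flatMap_map, P, List.flatMap_assoc, output_eachs,
      zero_add]
    refine List.flatMap_congr fun t _ => ?_
    induction extensions t.arity 0 e with
    | nil => rfl
    | cons f L ih =>
      rw [List.flatMap_cons, ih, List.filter_cons, output]
      simp only [realize_alls_isSelected, output_writeCompletion]
      split_ifs <;> simp_all

end RAM.Command

theorem mainTheorem3 :
    (∀ (V : Type*) [Fintype V] [Nonempty V] (G : SimpleGraph V),
      {H : SimpleGraph G.edgeSet | IsMinimalIntervalCompletion G.lineGraphᶜ H}.encard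
        ≤ (Fintype.card V : ℕ∞) ^ 5) ∧
    (∃ (p : RAM.Program) (C k : ℕ), ∀ (n : ℕ), 1 ≤ n → ∀ G : SimpleGraph (Fin n),
      ∃ (t : ℕ) (s : RAM.State), RAM.Exec (C * n ^ k) p (RAM.input G) t s ∧
        t ≤ C * n ^ 7 ∧ ListsMinimalCompletions G s.out) := by
  refine ⟨fun V _ _ G => Shape.encard_isMinimalIntervalCompletion_le G, ?_⟩
  obtain ⟨p, C, hp⟩ := RAM.Command.exists_program RAM.Command.writeAll RAM.Command.closed_writeAll
    RAM.Command.depth_writeAll (by norm_num)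
  refine ⟨p, C, 7, fun n hn G => ?_⟩
  obtain ⟨t, s, he, ht, ho⟩ := hp n hn G fun _ => ⟨0, hn⟩
  exact ⟨t, s, he, ht, ho ▸ RAM.Command.listsMinimalCompletions_writeAll G fun _ => ⟨0, hn⟩⟩
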